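/- Let $R$ be a nearly simple uniserial domain: a (noncommutative) domain whose left ideals form a chain and whose right ideals form a chain, and whose only two-sided ideal different from $0$ and $R$ is its Jacobson radical $J(R)$. Let $X_R$ be a right $R$-module isomorphic to $R/aR$ for some $0\neq a\in J(R)$, and let $S=\operatorname{End}_R X$ (a Dubrovin–Puninski ring), acting on $X$ from the left. Let $I\subseteq S$ be the ideal of non-monomorphisms, $K\subseteq S$ the ideal of non-epimorphisms, and $J=I\cap K$. All $S$-modules below are left modules. A submodule $N\subseteq M$ is pure if every morphism from a finitely presented module to $M/N$ lifts to $M$; a module $M$ is absolutely pure if $\operatorname{Ext}^1_S(G,M)=0$ for every finitely presented $G$; a module is uniserial if its submodules form a chain. A morphism $m:A\to B$ of $S$-modules is left almost split if it is not a split monomorphism and every morphism $A\to M$ that is not a split monomorphism factors through $m$; it is moreover minimal if every endomorphism $t$ of $B$ with $tm=m$ is an automorphism. Right almost split morphisms are defined dually, and a short exact sequence $0\to A\xrightarrow{i}B\xrightarrow{p}C\to 0$ is almost split if $i$ is left almost split and $p$ is right almost split. (1) There is a short exact sequence $0\to X\xrightarrow{f}X\xrightarrow{g}X\to 0$ of right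 $R$-modules. For every such $f,g\in S$ there is a countably generated left ideal $I_\omega$ with $Sg\subseteq I_\omega\subseteq I$ which is pure as a submodule of ${}_SI$ and satisfies $I_\omega f=J_\omega$ and $J_\omega f=J_\omega$, where $J_\omega=I_\omega\cap J$. (2) For all $f,g,I_\omega$ as in (1), the left $S$-module $I_\omega/Ig$ is absolutely pure, flat and uniserial. The map $s_\omega:S/I\to I_\omega/Ig$, $x+I\mapsto xg+Ig$, is a monomorphism whose image is the socle of $I_\omega/Ig$, and $s_\omega$ is left almost split in the category $S\text{-}\mathrm{Mod}$ of all left $S$-modules. (3) The left $S$-module $S/I$ is simple and not injective. There is no minimal left almost split morphism in $S\text{-}\mathrm{Mod}$ with domain $S/I$, and there is no almost split sequence $0\to S/I\to B\to C\to 0$ in $S\text{-}\mathrm{Mod}$. -/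

import Mathlib

open scoped TensorProduct
open MulOpposite (op)

universe u v w

namespace DubrovinPuninski

/-! ### General notions for left modules over an arbitrary ring -/

section Modules

variable (S : Type u) [Ring S]

/-- A module is uniserial if its submodules form a chain. -/
def IsUniserial (M : Type v) [AddCommGroup M] [Module S M] : Prop :=
  ∀ N P : Submodule S M, N ≤ P ∨ P ≤ N

/-- The socle: the sum of all simple submodules. -/
def socle (M : Type v) [AddCommGroup M] [Module S M] : Submodule S M :=
  sSup {N : Submodule S M | IsSimpleModule S N}

variable {S} in
/-- A submodule `N` of `M` is pure if every morphism from a finitely presented module to `M ⧸ N`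
lifts to `M`. -/
def IsPure {M : Type u} [AddCommGroup M] [Module S M] (N : Submodule S M) : Prop :=
  ∀ (G : Type u) [AddCommGroup G] [Module S G], Module.FinitePresentation S G →
    ∀ h : G →ₗ[S] M ⧸ N, ∃ k : G →ₗ[S] M, N.mkQ ∘ₗ k = h

/-- `M` is absolutely pure if `Ext¹(G, M) = 0` for every finitely presented module `G`. -/
def IsAbsolutelyPure (M : Type u) [AddCommGroup M] [Module S M] : Prop :=
  haveI : CategoryTheory.HasExt.{u} (ModuleCat.{u} S) :=
    CategoryTheory.hasExt_of_enoughProjectives (ModuleCat.{u} S)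
  ∀ (G : Type u) [AddCommGroup G] [Module S G], Module.FinitePresentation S G →
    Subsingleton (CategoryTheory.Abelian.Ext (ModuleCat.of S G) (ModuleCat.of S M) 1)

/-- The relations `n s ⊗ m = n ⊗ s m` in `N ⊗ M` (over the integers), for a right module `N` and a
left module `M`. -/
def balancedRel (N : Type v) [AddCommGroup N] [Module Sᵐᵒᵖ N]
    (M : Type w) [AddCommGroup M] [Module S M] : Submodule ℤ (N ⊗[ℤ] M) :=
  Submodule.span ℤ {t | ∃ (n : N) (s : S) (m : M), t = (op s • n) ⊗ₜ[ℤ] m - n ⊗ₜ[ℤ] (s • m)}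

/-- The tensor product of a right module and a left module over a (noncommutative) ring. -/
abbrev BalancedTensor (N : Type v) [AddCommGroup N] [Module Sᵐᵒᵖ N]
    (M : Type w) [AddCommGroup M] [Module S M] : Type (max v w) :=
  (N ⊗[ℤ] M) ⧸ balancedRel S N M

theorem balancedRel_le_comap {N N' : Type v} [AddCommGroup N] [Module Sᵐᵒᵖ N]
    [AddCommGroup N'] [Module Sᵐᵒᵖ N'] (φ : N →ₗ[Sᵐᵒᵖ] N')
    (M : Type w) [AddCommGroup M] [Module S M] :
    balancedRel S N M ≤
      (balancedRel S N' M).comap (LinearMap.rTensor M φ.toAddMonoidHom.toIntLinearMap) := by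
  refine Submodule.span_le.2 ?_
  rintro _ ⟨n, s, m, rfl⟩
  refine Submodule.subset_span ⟨φ n, s, m, ?_⟩
  simp

/-- The map `φ ⊗ M` induced by a morphism `φ` of right modules. -/
def balancedMap {N N' : Type v} [AddCommGroup N] [Module Sᵐᵒᵖ N]
    [AddCommGroup N'] [Module Sᵐᵒᵖ N'] (φ : N →ₗ[Sᵐᵒᵖ] N')
    (M : Type w) [AddCommGroup M] [Module S M] :
    BalancedTensor S N M →ₗ[ℤ] BalancedTensor S N' M :=
  Submodule.mapQ _ _ (LinearMap.rTensor M φ.toAddMonoidHom.toIntLinearMap)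
    (balancedRel_le_comap S φ M)

/-- A left module is flat if tensoring with it preserves monomorphisms of right modules. -/
def IsFlat (M : Type v) [AddCommGroup M] [Module S M] : Prop :=
  ∀ (N N' : Type u) [AddCommGroup N] [Module Sᵐᵒᵖ N] [AddCommGroup N'] [Module Sᵐᵒᵖ N']
    (φ : N →ₗ[Sᵐᵒᵖ] N'), Function.Injective φ → Function.Injective (balancedMap S φ M)

variable {S}

/-- Split monomorphisms. -/
def IsSplitMono {A B : Type v} [AddCommGroup A] [Module S A] [AddCommGroup B] [Module S B]
    (m : A →ₗ[S] B) : Prop :=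
  ∃ r : B →ₗ[S] A, r ∘ₗ m = LinearMap.id

/-- Split epimorphisms. -/
def IsSplitEpi {A B : Type v} [AddCommGroup A] [Module S A] [AddCommGroup B] [Module S B]
    (p : A →ₗ[S] B) : Prop :=
  ∃ r : B →ₗ[S] A, p ∘ₗ r = LinearMap.id

/-- Left almost split morphisms in the category of all left modules. -/
def IsLeftAlmostSplit {A B : Type v} [AddCommGroup A] [Module S A] [AddCommGroup B] [Module S B]
    (m : A →ₗ[S] B) : Prop :=
  ¬ IsSplitMono m ∧
    ∀ (M : Type v) [AddCommGroup M] [Module S M] (q : A →ₗ[S] M), ¬ IsSplitMono q →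
      ∃ k : B →ₗ[S] M, k ∘ₗ m = q

/-- Right almost split morphisms in the category of all left modules. -/
def IsRightAlmostSplit {A B : Type v} [AddCommGroup A] [Module S A] [AddCommGroup B] [Module S B]
    (p : A →ₗ[S] B) : Prop :=
  ¬ IsSplitEpi p ∧
    ∀ (M : Type v) [AddCommGroup M] [Module S M] (q : M →ₗ[S] B), ¬ IsSplitEpi q →
      ∃ k : M →ₗ[S] A, p ∘ₗ k = q

/-- A left almost split morphism `m : A → B` is minimal if every endomorphism `t` of `B` with
`t m = m` is an automorphism. -/
def IsMinimalLeftAlmostSplit {A B : Type v} [AddCommGroup A] [Module S A]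
    [AddCommGroup B] [Module S B] (m : A →ₗ[S] B) : Prop :=
  IsLeftAlmostSplit m ∧ ∀ t : B →ₗ[S] B, t ∘ₗ m = m → Function.Bijective t

/-- A short exact sequence `0 → A → B → C → 0` is almost split if its monomorphism is left almost
split and its epimorphism is right almost split. -/
def IsAlmostSplitSequence {A B C : Type v} [AddCommGroup A] [Module S A]
    [AddCommGroup B] [Module S B] [AddCommGroup C] [Module S C]
    (i : A →ₗ[S] B) (p : B →ₗ[S] C) : Prop :=
  Function.Injective i ∧ Function.Exact i p ∧ Function.Surjective p ∧
    IsLeftAlmostSplit i ∧ IsRightAlmostSplit p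

/-- Right multiplication by `x`, an endomorphism of the left module `S`. -/
def rightMul (x : S) : S →ₗ[S] S :=
  LinearMap.toSpanSingleton S S x

/-- The map `s : S / I → L / I g`, `x + I ↦ x g + I g`, where `L` is a left ideal containing `g`. -/
def pushoutMap (I L : Ideal S) (g : S) (hg : g ∈ L) :
    (S ⧸ I) →ₗ[S] (L ⧸ (Submodule.map (rightMul g) I).submoduleOf L) :=
  Submodule.mapQ I ((Submodule.map (rightMul g) I).submoduleOf L)
    (LinearMap.toSpanSingleton S L ⟨g, hg⟩)
    (fun x hx => ⟨x, hx, rfl⟩)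

end Modules

/-! ### Nearly simple uniserial domains -/

/-- A (not necessarily commutative) domain, uniserial on both sides, whose only nontrivial
two-sided ideal is the Jacobson radical. -/
structure IsNearlySimpleUniserialDomain (R : Type u) [Ring R] : Prop where
  isDomain : IsDomain R
  uniserial_left : IsUniserial R R
  uniserial_right : IsUniserial Rᵐᵒᵖ R
  twoSided_iff : ∀ A : Ideal R, A.IsTwoSided → ((A ≠ ⊥ ∧ A ≠ ⊤) ↔ A = Ring.jacobson R)

/-- The right ideal `a R`; right modules are modules over the opposite ring. -/
def principalRightIdeal {R : Type u} [Ring R] (a : R) : Submodule Rᵐᵒᵖ R :=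
  Submodule.span Rᵐᵒᵖ {a}

/-- `X` is (isomorphic to) `R / a R` for some nonzero `a` in the Jacobson radical. -/
def IsCyclicallyPresentedTorsion (R : Type u) [Ring R] (X : Type v) [AddCommGroup X]
    [Module Rᵐᵒᵖ X] : Prop :=
  ∃ a : R, a ∈ Ring.jacobson R ∧ a ≠ 0 ∧ Nonempty (X ≃ₗ[Rᵐᵒᵖ] (R ⧸ principalRightIdeal a))

section Ideals

variable {R : Type u} [Ring R] {X : Type v} [AddCommGroup X] [Module Rᵐᵒᵖ X]

theorem IsCyclicallyPresentedTorsion.nontrivial (hX : IsCyclicallyPresentedTorsion R X)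
    (hR : IsNearlySimpleUniserialDomain R) : Nontrivial X := by
  obtain ⟨a, ha, ha0, ⟨e⟩⟩ := hX
  have := hR.isDomain
  suffices h : principalRightIdeal a ≠ ⊤ by
    have := Submodule.Quotient.nontrivial_iff.2 h
    exact e.toEquiv.nontrivial
  intro h
  have h1 : (1 : R) ∈ principalRightIdeal a := h ▸ Submodule.mem_top
  obtain ⟨b, hb⟩ := Submodule.mem_span_singleton.1 h1
  have hab : a * b.unop = 1 := hb
  have hba : b.unop * a = 1 := by
    apply mul_left_cancel₀ ha0
    rw [← mul_assoc, hab, one_mul, mul_one]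
  have h2 : (1 : R) ∈ Ring.jacobson R := hba ▸ Ideal.mul_mem_left _ _ ha
  exact (((hR.twoSided_iff _ inferInstance).2 rfl).2) ((Ideal.eq_top_iff_one _).2 h2)

theorem IsCyclicallyPresentedTorsion.isUniserial (hX : IsCyclicallyPresentedTorsion R X)
    (hR : IsNearlySimpleUniserialDomain R) : IsUniserial Rᵐᵒᵖ X := by
  obtain ⟨a, -, -, ⟨e⟩⟩ := hX
  intro N P
  set π : R →ₗ[Rᵐᵒᵖ] X := e.symm.toLinearMap ∘ₗ (principalRightIdeal a).mkQ
  have hπ : Function.Surjective π := e.symm.surjective.comp (Submodule.mkQ_surjective _)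
  rcases hR.uniserial_right (N.comap π) (P.comap π) with h | h
  · exact Or.inl ((Submodule.comap_le_comap_iff_of_surjective hπ).1 h)
  · exact Or.inr ((Submodule.comap_le_comap_iff_of_surjective hπ).1 h)

/-- The ideal `I` of `S = End_R X` of morphisms that are not monomorphisms. -/
def idealI (hR : IsNearlySimpleUniserialDomain R) (hX : IsCyclicallyPresentedTorsion R X) :
    Ideal (Module.End Rᵐᵒᵖ X) where
  carrier := {s | ¬ Function.Injective s}
  zero_mem' := by
    have := hX.nontrivial hR
    intro h
    obtain ⟨x, hx⟩ := exists_ne (0 : X)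
    exact hx (h (by simp))
  add_mem' := by
    intro s t hs ht h
    have hs' : LinearMap.ker s ≠ ⊥ := fun e => hs (LinearMap.ker_eq_bot.1 e)
    have ht' : LinearMap.ker t ≠ ⊥ := fun e => ht (LinearMap.ker_eq_bot.1 e)
    obtain ⟨x, hx, hx0⟩ := (Submodule.ne_bot_iff _).1 hs'
    obtain ⟨y, hy, hy0⟩ := (Submodule.ne_bot_iff _).1 ht'
    rcases hX.isUniserial hR (LinearMap.ker s) (LinearMap.ker t) with h' | h'
    · have h1 : t x = 0 := h' hx
      have h2 : s x = 0 := hx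
      exact hx0 (h (by simp [h1, h2]))
    · have h1 : s y = 0 := h' hy
      have h2 : t y = 0 := hy
      exact hy0 (h (by simp [h1, h2]))
  smul_mem' := by
    intro r s hs h
    exact hs (Function.Injective.of_comp (f := r) h)

/-- The ideal `K` of `S = End_R X` of morphisms that are not epimorphisms. -/
def idealK (hR : IsNearlySimpleUniserialDomain R) (hX : IsCyclicallyPresentedTorsion R X) :
    Ideal (Module.End Rᵐᵒᵖ X) where
  carrier := {s | ¬ Function.Surjective s}
  zero_mem' := by
    have := hX.nontrivial hR
    intro h
    obtain ⟨x, hx⟩ := exists_ne (0 : X)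
    obtain ⟨y, hy⟩ := h x
    exact hx (by simpa using hy.symm)
  add_mem' := by
    intro s t hs ht h
    rcases hX.isUniserial hR (LinearMap.range s) (LinearMap.range t) with h' | h'
    · refine ht fun x => ?_
      obtain ⟨y, rfl⟩ := h x
      exact (LinearMap.range t).add_mem (h' ⟨y, rfl⟩) ⟨y, rfl⟩
    · refine hs fun x => ?_
      obtain ⟨y, rfl⟩ := h x
      exact (LinearMap.range s).add_mem ⟨y, rfl⟩ (h' ⟨y, rfl⟩)
  smul_mem' := by
    have := hX.nontrivial hR
    intro r s hs h
    have key : ∀ x, ∃ y, r (s y) = x := h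
    rcases hX.isUniserial hR (LinearMap.range s) (LinearMap.ker r) with h' | h'
    · obtain ⟨x, hx⟩ := exists_ne (0 : X)
      obtain ⟨y, hy⟩ := key x
      exact hx (hy ▸ (h' ⟨y, rfl⟩ : r (s y) = 0))
    · refine hs fun x => ?_
      obtain ⟨y, hy⟩ := key (r x)
      have h1 : x - s y ∈ LinearMap.ker r := by simp [hy]
      have h2 := (LinearMap.range s).add_mem (h' h1) ⟨y, rfl⟩
      simpa using h2

/-- The ideal `J = I ∩ K`. -/
def idealJ (hR : IsNearlySimpleUniserialDomain R) (hX : IsCyclicallyPresentedTorsion R X) :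
    Ideal (Module.End Rᵐᵒᵖ X) :=
  idealI hR hX ⊓ idealK hR hX

/-- `0 → X → X → X → 0` with maps `f` and `g` is a short exact sequence. -/
def IsShortExact (f g : Module.End Rᵐᵒᵖ X) : Prop :=
  Function.Injective f ∧ Function.Exact f g ∧ Function.Surjective g

/-- `Iω` is a countably generated pure submodule of `I` that contains `S g`, such that
`Iω f = Jω` and `Jω f = Jω`, where `Jω = Iω ∩ J`. -/
structure IsOmega (hR : IsNearlySimpleUniserialDomain R) (hX : IsCyclicallyPresentedTorsion R X)
    (f g : Module.End Rᵐᵒᵖ X) (Iω : Ideal (Module.End Rᵐᵒᵖ X)) : Prop where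
  le_I : Iω ≤ idealI hR hX
  countablyGenerated : ∃ s : Set (Module.End Rᵐᵒᵖ X), s.Countable ∧ Ideal.span s = Iω
  pure : IsPure (Iω.submoduleOf (idealI hR hX))
  mem : Ideal.span {g} ≤ Iω
  map_I : Submodule.map (rightMul f) Iω = Iω ⊓ idealJ hR hX
  map_J : Submodule.map (rightMul f) (Iω ⊓ idealJ hR hX) = Iω ⊓ idealJ hR hX

theorem IsOmega.g_mem {hR : IsNearlySimpleUniserialDomain R}
    {hX : IsCyclicallyPresentedTorsion R X} {f g : Module.End Rᵐᵒᵖ X}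
    {Iω : Ideal (Module.End Rᵐᵒᵖ X)} (h : IsOmega hR hX f g Iω) : g ∈ Iω :=
  h.mem (Ideal.subset_span rfl)

/-- The left `S`-module `Iω / I g`. -/
abbrev IomegaModIg (hR : IsNearlySimpleUniserialDomain R) (hX : IsCyclicallyPresentedTorsion R X)
    (g : Module.End Rᵐᵒᵖ X) (Iω : Ideal (Module.End Rᵐᵒᵖ X)) : Type v :=
  Iω ⧸ (Submodule.map (rightMul g) (idealI hR hX)).submoduleOf Iω

/-- The morphism `sω : S / I → Iω / I g`, `x + I ↦ x g + I g`. -/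
abbrev sOmega {hR : IsNearlySimpleUniserialDomain R} {hX : IsCyclicallyPresentedTorsion R X}
    {f g : Module.End Rᵐᵒᵖ X} {Iω : Ideal (Module.End Rᵐᵒᵖ X)} (h : IsOmega hR hX f g Iω) :
    (Module.End Rᵐᵒᵖ X ⧸ idealI hR hX) →ₗ[Module.End Rᵐᵒᵖ X] IomegaModIg hR hX g Iω :=
  pushoutMap (idealI hR hX) Iω g h.g_mem

end Ideals

end DubrovinPuninski

/-!
Let `S = End X`. Every nonzero element of `S` is a monomorphism times an epimorphism, and every
non-epic monomorphism and every non-monic epimorphism fits into an exact sequence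
`0 → X → X → X → 0` that is weakly universal for factorizations in `S`. Hence `S` is left Bézout
and left coherent.

Let `L ≤ I` be a pure left ideal containing an epimorphism `g`. Purity lets one solve `b y = c` in
`L / I g` whenever the annihilator of `b` kills `c`, so `L / I g` is absolutely pure; it is flat
because it is locally cyclic and relations `d c = 0` come from relations in `S`. A morphism
`q : S / I → N` that is not a split monomorphism has `q 1 ∈ I N`, since `N / I N` is semisimple.
If `L` is countably generated, it is the union of a chain of left ideals `S t₀ ≤ S t₁ ≤ ⋯` with
epimorphisms `t₀ = g` and `tₖ = xₖ tₖ₊₁`, and elements of `I N` can be divided successively by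
`x₀, x₁, …`. This gives a morphism `L → N` sending `g` to `q 1`, hence a factorization of `q`
through `S / I → L / I g`. The left ideal `I_ω` is such a union with all `xₖ` in `I`, which makes
it pure, and with `tₖ` chosen so as to absorb the products with `f`.

A minimal left almost split morphism out of `S / I` would have a cyclic codomain, mapping onto
`L / I g`, which is not cyclic. The first map of an almost split sequence is always minimal.
-/

namespace DubrovinPuninski

section Factorization

variable {S : Type u} [Ring S] {A B C : Type*} [AddCommGroup A] [Module S A]
  [AddCommGroup B] [Module S B] [AddCommGroup C] [Module S C]

theorem exists_comp_eq_of_ker_le {g : A →ₗ[S] B} (hg : Function.Surjective g) {t : A →ₗ[S] C}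
    (h : LinearMap.ker g ≤ LinearMap.ker t) : ∃ y : B →ₗ[S] C, y ∘ₗ g = t := by
  refine ⟨(LinearMap.ker g).liftQ t h ∘ₗ (g.quotKerEquivOfSurjective hg).symm.toLinearMap, ?_⟩
  ext x
  have hx : (g.quotKerEquivOfSurjective hg).symm (g x) = (LinearMap.ker g).mkQ x := by
    rw [LinearEquiv.symm_apply_eq]
    rfl
  simp only [LinearMap.comp_apply, LinearEquiv.coe_coe, hx]
  rfl

theorem exists_comp_eq_of_range_le {f : B →ₗ[S] C} (hf : Function.Injective f) {t : A →ₗ[S] C}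
    (h : LinearMap.range t ≤ LinearMap.range f) : ∃ y : A →ₗ[S] B, f ∘ₗ y = t := by
  refine ⟨(LinearEquiv.ofInjective f hf).symm.toLinearMap ∘ₗ
    t.codRestrict (LinearMap.range f) (fun x => h ⟨x, rfl⟩), ?_⟩
  ext x
  exact LinearEquiv.ofInjective_symm_apply f (h := hf) ⟨t x, h ⟨x, rfl⟩⟩

end Factorization

namespace IsNearlySimpleUniserialDomain

variable {R : Type u} [Ring R]

theorem jacobson_ne_top (hR : IsNearlySimpleUniserialDomain R) : Ring.jacobson R ≠ ⊤ :=
  ((hR.twoSided_iff _ inferInstance).2 rfl).2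

theorem mem_jacobson_iff (hR : IsNearlySimpleUniserialDomain R) {r : R} :
    r ∈ Ring.jacobson R ↔ ¬ IsUnit r := by
  have := hR.isDomain
  refine ⟨fun h hu => hR.jacobson_ne_top (Ideal.eq_top_of_isUnit_mem _ h hu), fun h => ?_⟩
  have hne : Ideal.span {r} ≠ ⊤ := fun htop => by
    obtain ⟨w, hw⟩ := Ideal.mem_span_singleton'.1 ((Ideal.eq_top_iff_one _).1 htop)
    exact h (IsUnit.of_mul_eq_one_right w hw)
  refine Submodule.mem_sInf.2 fun m (hm : IsCoatom m) => ?_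
  have hle : Ideal.span {r} ≤ m :=
    (hR.uniserial_left (Ideal.span {r}) m).elim id fun h => ((hm.le_iff.1 h).resolve_left hne).le
  exact hle (Ideal.mem_span_singleton_self r)

theorem isUnit_add (hR : IsNearlySimpleUniserialDomain R) {x y : R}
    (hx : x ∈ Ring.jacobson R) (hy : IsUnit y) : IsUnit (x + y) := by
  by_contra h
  exact hR.mem_jacobson_iff.1 (((Ring.jacobson R).add_mem_iff_right hx).1
    (hR.mem_jacobson_iff.2 h)) hy

theorem exists_mem_jacobson_eq_mul_or (hR : IsNearlySimpleUniserialDomain R) (p q : R) :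
    (∃ w ∈ Ring.jacobson R, p = w * q) ∨ ∃ w, q = w * p := by
  rcases hR.uniserial_left (Ideal.span {p}) (Ideal.span {q}) with h | h
  · obtain ⟨w, rfl⟩ := Ideal.mem_span_singleton'.1 (h (Ideal.mem_span_singleton_self p))
    by_cases hw : w ∈ Ring.jacobson R
    · exact Or.inl ⟨w, hw, rfl⟩
    · obtain ⟨w, rfl⟩ := not_not.1 (mt hR.mem_jacobson_iff.2 hw)
      exact Or.inr ⟨↑w⁻¹, by simp⟩
  · obtain ⟨w, rfl⟩ := Ideal.mem_span_singleton'.1 (h (Ideal.mem_span_singleton_self q))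
    exact Or.inr ⟨w, rfl⟩

theorem exists_mem_jacobson_eq_mul_or' (hR : IsNearlySimpleUniserialDomain R) (p q : R) :
    (∃ w ∈ Ring.jacobson R, p = q * w) ∨ ∃ w, q = p * w := by
  rcases hR.uniserial_right (principalRightIdeal p) (principalRightIdeal q) with h | h
  · obtain ⟨w, rfl⟩ := Submodule.mem_span_singleton.1 (h (Submodule.mem_span_singleton_self p))
    by_cases hw : w.unop ∈ Ring.jacobson R
    · exact Or.inl ⟨w.unop, hw, rfl⟩
    · obtain ⟨u, hu⟩ := not_not.1 (mt hR.mem_jacobson_iff.2 hw)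
      exact Or.inr ⟨↑u⁻¹, by simp [MulOpposite.smul_eq_mul_unop, ← hu]⟩
  · obtain ⟨w, rfl⟩ := Submodule.mem_span_singleton.1 (h (Submodule.mem_span_singleton_self q))
    exact Or.inr ⟨w.unop, rfl⟩

/-- The products `x a y` already form an ideal: two of them have a common right factor `a y`. -/
theorem exists_eq_mul_mul (hR : IsNearlySimpleUniserialDomain R) {a b : R}
    (ha : a ∈ Ring.jacobson R) (ha0 : a ≠ 0) (hb : b ∈ Ring.jacobson R) :
    ∃ x ∈ Ring.jacobson R, ∃ y ∈ Ring.jacobson R, b = x * a * y := by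
  have := hR.isDomain
  let A : Ideal R :=
    { carrier := {b | ∃ x ∈ Ring.jacobson R, ∃ y ∈ Ring.jacobson R, b = x * a * y}
      zero_mem' := ⟨0, zero_mem _, 0, zero_mem _, by simp⟩
      add_mem' := by
        rintro _ _ ⟨x, hx, y, hy, rfl⟩ ⟨x', hx', y', hy', rfl⟩
        rcases hR.exists_mem_jacobson_eq_mul_or (a * y) (a * y') with ⟨w, -, hw⟩ | ⟨w, hw⟩
        · refine ⟨x * w + x', add_mem (Ideal.mul_mem_right _ _ hx) hx', y', hy', ?_⟩
          simp only [mul_assoc, add_mul, hw]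
        · refine ⟨x + x' * w, add_mem hx (Ideal.mul_mem_right _ _ hx'), y, hy, ?_⟩
          simp only [mul_assoc, add_mul, hw]
      smul_mem' := by
        rintro r _ ⟨x, hx, y, hy, rfl⟩
        exact ⟨r * x, Ideal.mul_mem_left _ _ hx, y, hy, by simp [mul_assoc]⟩ }
  have hA : A.IsTwoSided := ⟨by
    rintro _ r ⟨x, hx, y, hy, rfl⟩
    exact ⟨x, hx, y * r, Ideal.mul_mem_right _ _ hy, by simp [mul_assoc]⟩⟩
  have hA_eq : A = Ring.jacobson R := by
    refine (hR.twoSided_iff A hA).1 ⟨?_, ne_top_of_le_ne_top hR.jacobson_ne_top ?_⟩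
    · exact (Submodule.ne_bot_iff _).2 ⟨a * a * a, ⟨a, ha, a, ha, rfl⟩, by simp [ha0]⟩
    · rintro _ ⟨x, -, y, hy, rfl⟩
      exact Ideal.mul_mem_left _ _ hy
  exact hA_eq.ge hb

theorem exists_eq_mul_mul_unit (hR : IsNearlySimpleUniserialDomain R) {a c : R}
    (ha : a ∈ Ring.jacobson R) (ha0 : a ≠ 0) (hc : c ∈ Ring.jacobson R) (hc0 : c ≠ 0) :
    ∃ x ∈ Ring.jacobson R, ∃ u : Rˣ, a = x * c * u := by
  have := hR.isDomain
  obtain ⟨x, hx, y, hy, hxy⟩ := hR.exists_eq_mul_mul hc hc0 ha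
  rcases hR.exists_mem_jacobson_eq_mul_or a c with ⟨w, hw, h⟩ | ⟨w, hwa⟩
  · exact ⟨w, hw, 1, by simpa using h⟩
  obtain ⟨u, hu⟩ := hR.isUnit_add hy isUnit_one
  rcases hR.exists_mem_jacobson_eq_mul_or a (c * u) with ⟨w', hw, h⟩ | ⟨w', hwa'⟩
  · exact ⟨w', hw, u, by rw [h, mul_assoc]⟩
  have hcy : c * y = (w' - w) * a := by
    rw [sub_mul, ← hwa', ← hwa, hu]
    noncomm_ring
  have hx1 : x * (w' - w) = 1 := mul_right_cancel₀ ha0 <| by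
    rw [mul_assoc, ← hcy, ← mul_assoc, ← hxy, one_mul]
  exact absurd (IsUnit.of_mul_eq_one _ hx1) (hR.mem_jacobson_iff.1 hx)

theorem exists_eq_unit_mul_mul (hR : IsNearlySimpleUniserialDomain R) {a c : R}
    (ha : a ∈ Ring.jacobson R) (ha0 : a ≠ 0) (hc : c ∈ Ring.jacobson R) (hc0 : c ≠ 0) :
    ∃ u : Rˣ, ∃ y ∈ Ring.jacobson R, a = u * c * y := by
  have := hR.isDomain
  obtain ⟨x, hx, y, hy, hxy⟩ := hR.exists_eq_mul_mul hc hc0 ha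
  rcases hR.exists_mem_jacobson_eq_mul_or' a c with ⟨w, hw, h⟩ | ⟨w, hwa⟩
  · exact ⟨1, w, hw, by simpa using h⟩
  obtain ⟨u, hu⟩ := hR.isUnit_add hx isUnit_one
  rcases hR.exists_mem_jacobson_eq_mul_or' a (u * c) with ⟨w', hw, h⟩ | ⟨w', hwa'⟩
  · exact ⟨u, w', hw, h⟩
  have hxc : x * c = a * (w' - w) := by
    rw [mul_sub, ← hwa', ← hwa, hu]
    noncomm_ring
  have hy1 : (w' - w) * y = 1 := mul_left_cancel₀ ha0 <| by
    rw [← mul_assoc, ← hxc, ← hxy, mul_one]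
  exact absurd (IsUnit.of_mul_eq_one_right _ hy1) (hR.mem_jacobson_iff.1 hy)

theorem exists_unit_mul_eq_mul_unit (hR : IsNearlySimpleUniserialDomain R) {a c : R}
    (ha : a ∈ Ring.jacobson R) (ha0 : a ≠ 0) (hc : c ∈ Ring.jacobson R) (hc0 : c ≠ 0) :
    ∃ p q : Rˣ, p * c = a * q := by
  obtain ⟨x, hx, u, hxu⟩ := hR.exists_eq_mul_mul_unit ha ha0 hc hc0
  obtain ⟨w, y, hy, hwy⟩ := hR.exists_eq_unit_mul_mul hc hc0 ha ha0
  obtain ⟨p, hp⟩ := hR.isUnit_add hx (w⁻¹).isUnit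
  obtain ⟨q, hq⟩ := hR.isUnit_add hy (u⁻¹).isUnit
  have hxc : x * c = a * ↑u⁻¹ := by simp [hxu]
  have hwc : ↑w⁻¹ * c = a * y := by simp [hwy, mul_assoc]
  exact ⟨p, q, by rw [hp, hq, add_mul, mul_add, hxc, hwc, add_comm]⟩

end IsNearlySimpleUniserialDomain

section Presented

variable {R : Type u} [Ring R] {X : Type v} [AddCommGroup X] [Module Rᵐᵒᵖ X]

/-- The right module `X` is generated by `ε`, and the annihilator of `ε` is `a R`; equivalently,
`1 ↦ ε` induces an isomorphism `R / a R ≅ X`. -/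
structure IsPresentedBy (ε : X) (a : R) : Prop where
  exists_smul : ∀ x : X, ∃ r : R, op r • ε = x
  smul_eq_zero : ∀ r : R, op r • ε = 0 ↔ ∃ t, r = a * t

/-- The endomorphism `s` of `X ≅ R / a R` is left multiplication by `r`. The element `r'`, which
satisfies `r a = a r'`, is the action of a lift of `s` on the kernel of the projective cover
`R → X`. -/
structure Represents (ε : X) (a : R) (s : Module.End Rᵐᵒᵖ X) (r r' : R) : Prop where
  apply_gen : s ε = op r • ε
  comm : r * a = a * r'

namespace Represents

variable {ε : X} {a : R} {s t : Module.End Rᵐᵒᵖ X} {r r' q q' : R}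

theorem apply_smul (hs : Represents ε a s r r') (k : R) : s (op k • ε) = op (r * k) • ε := by
  rw [map_smul, hs.apply_gen, smul_smul, MulOpposite.op_mul]

theorem mul (hs : Represents ε a s r r') (ht : Represents ε a t q q') :
    Represents ε a (s * t) (r * q) (r' * q') where
  apply_gen := by rw [Module.End.mul_apply, ht.apply_gen, hs.apply_smul]
  comm := by rw [mul_assoc, ht.comm, ← mul_assoc, hs.comm, mul_assoc]

end Represents

namespace IsPresentedBy

variable {ε : X} {a : R}

theorem hom_ext (hε : IsPresentedBy ε a) {s t : Module.End Rᵐᵒᵖ X} (h : s ε = t ε) : s = t := by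
  ext x
  obtain ⟨r, rfl⟩ := hε.exists_smul x
  rw [map_smul, map_smul, h]

theorem exists_represents (hε : IsPresentedBy ε a) (s : Module.End Rᵐᵒᵖ X) :
    ∃ r r', Represents ε a s r r' := by
  obtain ⟨r, hr⟩ := hε.exists_smul (s ε)
  have h : op (r * a) • ε = 0 := by
    rw [MulOpposite.op_mul, mul_smul, hr, ← map_smul, (hε.smul_eq_zero a).2 ⟨1, by simp⟩, map_zero]
  obtain ⟨r', hr'⟩ := (hε.smul_eq_zero _).1 h
  exact ⟨r, r', hr.symm, hr'⟩

theorem exists_end_represents (hε : IsPresentedBy ε a) {r r' : R} (h : r * a = a * r') :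
    ∃ s : Module.End Rᵐᵒᵖ X, Represents ε a s r r' := by
  let φ : Rᵐᵒᵖ →ₗ[Rᵐᵒᵖ] X := LinearMap.toSpanSingleton Rᵐᵒᵖ X ε
  let ψ : Rᵐᵒᵖ →ₗ[Rᵐᵒᵖ] X := LinearMap.toSpanSingleton Rᵐᵒᵖ X (op r • ε)
  have hφ : Function.Surjective φ := fun x => by
    obtain ⟨k, hk⟩ := hε.exists_smul x
    exact ⟨op k, hk⟩
  have hker : LinearMap.ker φ ≤ LinearMap.ker ψ := fun q hq => by
    obtain ⟨t, ht⟩ := (hε.smul_eq_zero q.unop).1 hq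
    change q • op r • ε = 0
    rw [smul_smul, ← MulOpposite.op_unop q, ← MulOpposite.op_mul, ht, ← mul_assoc, h, mul_assoc]
    exact (hε.smul_eq_zero _).2 ⟨_, rfl⟩
  obtain ⟨s, hs⟩ := exists_comp_eq_of_ker_le hφ hker
  exact ⟨s, by simpa [φ, ψ] using LinearMap.congr_fun hs 1, h⟩

end IsPresentedBy

variable {ε : X} {a : R}

theorem Represents.eq_of_eq (hε : IsPresentedBy ε a) {s t : Module.End Rᵐᵒᵖ X} {r r' q' : R}
    (hs : Represents ε a s r r') (ht : Represents ε a t r q') : s = t :=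
  hε.hom_ext (hs.apply_gen.trans ht.apply_gen.symm)

theorem Represents.exists_eq_mul_right (hε : IsPresentedBy ε a) {f s : Module.End Rᵐᵒᵖ X}
    {r t' z : R} {r' : Rˣ} (hf : Represents ε a f r r') (hs : Represents ε a s (z * r) t') :
    ∃ y, s = y * f := by
  have comm : z * a = a * (t' * ↑r'⁻¹) := by
    rw [← mul_assoc, ← hs.comm, mul_assoc z, hf.comm, mul_assoc z, Units.mul_inv_cancel_right]
  obtain ⟨y, hy⟩ := hε.exists_end_represents comm
  exact ⟨y, hs.eq_of_eq hε (hy.mul hf)⟩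

theorem Represents.exists_eq_mul_left (hε : IsPresentedBy ε a) {g s : Module.End Rᵐᵒᵖ X}
    {r' t z : R} {r : Rˣ} (hg : Represents ε a g r r') (hs : Represents ε a s t (r' * z)) :
    ∃ y, s = g * y := by
  have comm : ↑r⁻¹ * t * a = a * z := by
    rw [mul_assoc, hs.comm, ← mul_assoc a, ← hg.comm, mul_assoc, Units.inv_mul_cancel_left]
  obtain ⟨y, hy⟩ := hε.exists_end_represents comm
  exact ⟨y, hs.eq_of_eq hε (by simpa using hg.mul hy)⟩

/-- A presentation `X ≅ R / a R` with `0 ≠ a ∈ J(R)`. -/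
structure IsTorsionPresentation (ε : X) (a : R) : Prop extends IsPresentedBy ε a where
  mem_jacobson : a ∈ Ring.jacobson R
  ne_zero : a ≠ 0

theorem IsCyclicallyPresentedTorsion.exists_isTorsionPresentation
    (hX : IsCyclicallyPresentedTorsion R X) : ∃ (ε : X) (a : R), IsTorsionPresentation ε a := by
  obtain ⟨a, ha, ha0, ⟨e⟩⟩ := hX
  have smul_symm : ∀ r : R, op r • e.symm ((principalRightIdeal a).mkQ 1) =
      e.symm ((principalRightIdeal a).mkQ r) := fun r => by
    rw [← map_smul, ← map_smul, op_smul_eq_mul, one_mul]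
  refine ⟨e.symm ((principalRightIdeal a).mkQ 1), a, ⟨fun x => ?_, fun r => ?_⟩, ha, ha0⟩
  · obtain ⟨r, hr⟩ := Submodule.mkQ_surjective _ (e x)
    exact ⟨r, by rw [smul_symm, hr, e.symm_apply_apply]⟩
  · rw [smul_symm, LinearEquiv.map_eq_zero_iff, Submodule.mkQ_apply, Submodule.Quotient.mk_eq_zero,
      principalRightIdeal, Submodule.mem_span_singleton]
    exact ⟨fun ⟨t, ht⟩ => ⟨t.unop, ht.symm⟩, fun ⟨t, ht⟩ => ⟨op t, ht.symm⟩⟩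

namespace Represents

variable {s : Module.End Rᵐᵒᵖ X} {r r' : R}

theorem surjective_iff (hR : IsNearlySimpleUniserialDomain R) (hε : IsTorsionPresentation ε a)
    (hs : Represents ε a s r r') : Function.Surjective s ↔ IsUnit r := by
  constructor
  · intro h
    obtain ⟨x, hx⟩ := h ε
    obtain ⟨q, rfl⟩ := hε.exists_smul x
    have h0 : op (r * q - 1) • ε = 0 := by
      rw [MulOpposite.op_sub, sub_smul, ← hs.apply_smul, hx, MulOpposite.op_one, one_smul, sub_self]
    obtain ⟨t, ht⟩ := (hε.smul_eq_zero _).1 h0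
    by_contra hr
    have h1 : r * q - a * t ∈ Ring.jacobson R :=
      sub_mem (Ideal.mul_mem_right _ _ (hR.mem_jacobson_iff.2 hr))
        (Ideal.mul_mem_right _ _ hε.mem_jacobson)
    rw [← ht, sub_sub_cancel] at h1
    exact hR.mem_jacobson_iff.1 h1 isUnit_one
  · rintro ⟨p, rfl⟩ x
    obtain ⟨q, rfl⟩ := hε.exists_smul x
    exact ⟨op (↑p⁻¹ * q) • ε, by rw [hs.apply_smul, Units.mul_inv_cancel_left]⟩

theorem exists_mul_eq (hR : IsNearlySimpleUniserialDomain R) (hε : IsTorsionPresentation ε a)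
    (hs : Represents ε a s r r') (hs0 : s ≠ 0) :
    ∃ c ∈ Ring.jacobson R, r * c = a ∧ c * r' = a := by
  have := hR.isDomain
  rcases hR.exists_mem_jacobson_eq_mul_or' a r with ⟨c, hc, hrc⟩ | h
  · have hr0 : r ≠ 0 := left_ne_zero_of_mul (hrc ▸ hε.ne_zero)
    refine ⟨c, hc, hrc.symm, mul_left_cancel₀ hr0 ?_⟩
    rw [← mul_assoc, ← hrc, hs.comm]
  · refine absurd (hε.hom_ext ?_) hs0
    rw [hs.apply_gen, (hε.smul_eq_zero _).2 h, LinearMap.zero_apply]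

theorem apply_smul_eq_zero_iff (hR : IsNearlySimpleUniserialDomain R)
    (hε : IsTorsionPresentation ε a) (hs : Represents ε a s r r') {c : R} (hrc : r * c = a)
    (k : R) : s (op k • ε) = 0 ↔ ∃ t, k = c * t := by
  have := hR.isDomain
  have hr0 : r ≠ 0 := left_ne_zero_of_mul (hrc ▸ hε.ne_zero)
  simp only [hs.apply_smul, hε.smul_eq_zero, ← hrc, mul_assoc, mul_right_inj' hr0]

theorem smul_mem_range_iff (hε : IsPresentedBy ε a) (hs : Represents ε a s r r') {c : R}
    (hrc : r * c = a) (k : R) : op k • ε ∈ Set.range s ↔ ∃ t, k = r * t := by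
  constructor
  · rintro ⟨x, hx⟩
    obtain ⟨q, rfl⟩ := hε.exists_smul x
    have h0 : op (k - r * q) • ε = 0 := by
      rw [MulOpposite.op_sub, sub_smul, ← hs.apply_smul, hx, sub_self]
    obtain ⟨t, ht⟩ := (hε.smul_eq_zero _).1 h0
    exact ⟨c * t + q, by rw [mul_add, ← mul_assoc, hrc, ← ht, sub_add_cancel]⟩
  · rintro ⟨t, rfl⟩
    exact ⟨op t • ε, hs.apply_smul t⟩

theorem injective_iff (hR : IsNearlySimpleUniserialDomain R) (hε : IsTorsionPresentation ε a)
    (hs : Represents ε a s r r') : Function.Injective s ↔ IsUnit r' := by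
  have := hR.isDomain
  constructor
  · intro h
    have hs0 : s ≠ 0 := by
      rintro rfl
      obtain ⟨t, ht⟩ := (hε.smul_eq_zero 1).1 (h rfl)
      exact hR.mem_jacobson_iff.1 (Ideal.mul_mem_right t _ hε.mem_jacobson) (ht ▸ isUnit_one)
    obtain ⟨c, -, hrc, hcr⟩ := hs.exists_mul_eq hR hε hs0
    have hc : s (op c • ε) = 0 := (hs.apply_smul_eq_zero_iff hR hε hrc c).2 ⟨1, by simp⟩
    obtain ⟨w, hw⟩ := (hε.smul_eq_zero c).1 (h (hc.trans (map_zero s).symm))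
    refine IsUnit.of_mul_eq_one w (mul_left_cancel₀ (a := c) ?_ ?_)
    · exact left_ne_zero_of_mul (hcr ▸ hε.ne_zero)
    · rw [← mul_assoc, hcr, ← hw, mul_one]
  · refine fun h => (injective_iff_map_eq_zero s).2 fun x hx => ?_
    obtain ⟨q, rfl⟩ := hε.exists_smul x
    rw [hs.apply_smul] at hx
    obtain ⟨t, ht⟩ := (hε.smul_eq_zero _).1 hx
    rcases hR.exists_mem_jacobson_eq_mul_or' a q with ⟨w, hw, haw⟩ | hq
    · have hr' : r' = t * w := mul_left_cancel₀ hε.ne_zero <| by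
        rw [← hs.comm, ← mul_assoc, ← ht, mul_assoc, ← haw]
      exact absurd h (hR.mem_jacobson_iff.1 (hr' ▸ Ideal.mul_mem_left _ t hw))
    · exact (hε.smul_eq_zero q).2 hq

end Represents

end Presented

theorem isUnit_add_of_notMem {S : Type u} [Ring S] {I K : Ideal S}
    (isUnit : ∀ s, s ∉ I → s ∉ K → IsUnit s) {f g : S} (hfK : f ∈ K) (hfI : f ∉ I) (hgI : g ∈ I)
    (hgK : g ∉ K) : IsUnit (f + g) :=
  isUnit _ (fun h => hfI ((I.add_mem_iff_left hgI).1 h))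
    fun h => hgK ((K.add_mem_iff_right hfK).1 h)

namespace IsCyclicallyPresentedTorsion

variable {R : Type u} [Ring R] {X : Type v} [AddCommGroup X] [Module Rᵐᵒᵖ X]

theorem exists_injective_not_surjective (hX : IsCyclicallyPresentedTorsion R X)
    (hR : IsNearlySimpleUniserialDomain R) :
    ∃ f : Module.End Rᵐᵒᵖ X, Function.Injective f ∧ ¬ Function.Surjective f := by
  obtain ⟨ε, a, hε⟩ := hX.exists_isTorsionPresentation
  obtain ⟨x, hx, u, hxu⟩ := hR.exists_eq_mul_mul_unit hε.mem_jacobson hε.ne_zero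
    hε.mem_jacobson hε.ne_zero
  have comm : x * a = a * ↑u⁻¹ := (Units.eq_mul_inv_iff_mul_eq u).2 hxu.symm
  obtain ⟨f, hf⟩ := hε.exists_end_represents comm
  exact ⟨f, (hf.injective_iff hR hε).2 (Units.isUnit _),
    fun h => hR.mem_jacobson_iff.1 hx ((hf.surjective_iff hR hε).1 h)⟩

theorem exists_exact_right (hX : IsCyclicallyPresentedTorsion R X)
    (hR : IsNearlySimpleUniserialDomain R) {s : Module.End Rᵐᵒᵖ X} (hs0 : s ≠ 0)
    (hs : ¬ Function.Surjective s) : ∃ g : Module.End Rᵐᵒᵖ X,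
      Function.Surjective g ∧ ¬ Function.Injective g ∧ Function.Exact s g := by
  have := hR.isDomain
  obtain ⟨ε, a, hε⟩ := hX.exists_isTorsionPresentation
  obtain ⟨r, r', hsr⟩ := hε.exists_represents s
  obtain ⟨c, hc, hrc, -⟩ := hsr.exists_mul_eq hR hε hs0
  have hr : r ∈ Ring.jacobson R := hR.mem_jacobson_iff.2
    fun h => hs ((hsr.surjective_iff hR hε).2 h)
  obtain ⟨p, q, hpq⟩ := hR.exists_unit_mul_eq_mul_unit hε.mem_jacobson hε.ne_zero hr
    (left_ne_zero_of_mul (hrc ▸ hε.ne_zero))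
  obtain ⟨g, hg⟩ := hε.exists_end_represents (r := p) (r' := q * c)
    (by rw [← mul_assoc, ← hpq, mul_assoc, hrc])
  refine ⟨g, (hg.surjective_iff hR hε).2 p.isUnit, fun h => ?_, fun x => ?_⟩
  · exact hR.mem_jacobson_iff.1 (Ideal.mul_mem_left _ _ hc) ((hg.injective_iff hR hε).1 h)
  · obtain ⟨k, rfl⟩ := hε.exists_smul x
    rw [hg.apply_smul, hε.smul_eq_zero, hsr.smul_mem_range_iff hε.toIsPresentedBy hrc]
    have h : ∀ t, a * t = p * (r * (↑q⁻¹ * t)) := fun t => by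
      rw [← mul_assoc, ← mul_assoc, hpq, Units.mul_inv_cancel_right]
    simp only [h, Units.mul_right_inj]
    exact ⟨fun ⟨t, ht⟩ => ⟨_, ht⟩, fun ⟨t, ht⟩ => ⟨q * t, by simpa using ht⟩⟩

theorem exists_exact_left (hX : IsCyclicallyPresentedTorsion R X)
    (hR : IsNearlySimpleUniserialDomain R) {s : Module.End Rᵐᵒᵖ X} (hs0 : s ≠ 0)
    (hs : ¬ Function.Injective s) : ∃ f : Module.End Rᵐᵒᵖ X,
      Function.Injective f ∧ ¬ Function.Surjective f ∧ Function.Exact f s := by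
  have := hR.isDomain
  obtain ⟨ε, a, hε⟩ := hX.exists_isTorsionPresentation
  obtain ⟨r, r', hsr⟩ := hε.exists_represents s
  obtain ⟨c, hc, hrc, hcr⟩ := hsr.exists_mul_eq hR hε hs0
  have hr' : r' ∈ Ring.jacobson R := hR.mem_jacobson_iff.2
    fun h => hs ((hsr.injective_iff hR hε).2 h)
  obtain ⟨p, q, hpq⟩ := hR.exists_unit_mul_eq_mul_unit hr'
    (right_ne_zero_of_mul (hcr ▸ hε.ne_zero)) hε.mem_jacobson hε.ne_zero
  obtain ⟨f, hf⟩ := hε.exists_end_represents (r := c * p) (r' := q)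
    (by rw [mul_assoc, hpq, ← mul_assoc, hcr])
  refine ⟨f, (hf.injective_iff hR hε).2 q.isUnit, fun h => ?_, fun x => ?_⟩
  · exact hR.mem_jacobson_iff.1 (Ideal.mul_mem_right _ _ hc) ((hf.surjective_iff hR hε).1 h)
  · obtain ⟨k, rfl⟩ := hε.exists_smul x
    rw [hsr.apply_smul_eq_zero_iff hR hε hrc, hf.smul_mem_range_iff hε.toIsPresentedBy
      (c := ↑p⁻¹ * r') (by rw [← mul_assoc, Units.mul_inv_cancel_right, hcr])]
    exact ⟨fun ⟨t, ht⟩ => ⟨↑p⁻¹ * t, by simpa [mul_assoc] using ht⟩,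
      fun ⟨t, ht⟩ => ⟨p * t, by rw [ht, mul_assoc]⟩⟩

theorem exists_eq_injective_mul_surjective (hX : IsCyclicallyPresentedTorsion R X)
    (hR : IsNearlySimpleUniserialDomain R) {s : Module.End Rᵐᵒᵖ X} (hs0 : s ≠ 0) :
    ∃ f g : Module.End Rᵐᵒᵖ X, Function.Injective f ∧ Function.Surjective g ∧ s = f * g := by
  by_cases hs : Function.Injective s
  · exact ⟨s, 1, hs, Function.surjective_id, (mul_one s).symm⟩
  have := hX.nontrivial hR
  obtain ⟨f, hf, hfs, hfs_exact⟩ := hX.exists_exact_left hR hs0 hs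
  have hf0 : f ≠ 0 := by
    rintro rfl
    exact not_subsingleton X ⟨fun _ _ => hf rfl⟩
  obtain ⟨g, hg, -, hfg_exact⟩ := hX.exists_exact_right hR hf0 hfs
  have hker : ∀ x, s x = 0 ↔ g x = 0 := fun x => (hfs_exact x).trans (hfg_exact x).symm
  obtain ⟨y, rfl⟩ := exists_comp_eq_of_ker_le hg fun x hx => (hker x).2 hx
  refine ⟨y, g, (injective_iff_map_eq_zero y).2 fun z hz => ?_, hg, rfl⟩
  obtain ⟨x, rfl⟩ := hg z
  exact (hker x).1 hz

theorem isUnit_add (hX : IsCyclicallyPresentedTorsion R X) (hR : IsNearlySimpleUniserialDomain R)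
    {f g : Module.End Rᵐᵒᵖ X} (hf : Function.Injective f) (hf' : ¬ Function.Surjective f)
    (hg : Function.Surjective g) (hg' : ¬ Function.Injective g) : IsUnit (f + g) :=
  isUnit_add_of_notMem (I := idealI hR hX) (K := idealK hR hX)
    (fun s hsI hsK => (Module.End.isUnit_iff s).2 ⟨not_not.1 hsI, not_not.1 hsK⟩) hf'
    (not_not.2 hf) hg' (not_not.2 hg)

/-- If `b s` factors through `f` and `e s = 0`, then `s` factors through `f` as soon as `b + e` is a
unit. -/
theorem exists_eq_mul_injective (hX : IsCyclicallyPresentedTorsion R X)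
    (hR : IsNearlySimpleUniserialDomain R) {f s : Module.End Rᵐᵒᵖ X}
    (hf : Function.Injective f) (hs : ¬ Function.Surjective s) : ∃ y, s = y * f := by
  have := hR.isDomain
  by_cases hs0 : s = 0
  · exact ⟨0, by simp [hs0]⟩
  obtain ⟨ε, a, hε⟩ := hX.exists_isTorsionPresentation
  obtain ⟨r, r', hfr⟩ := hε.exists_represents f
  obtain ⟨r', rfl⟩ := (hfr.injective_iff hR hε).1 hf
  obtain ⟨t, t', hst⟩ := hε.exists_represents s
  rcases hR.exists_mem_jacobson_eq_mul_or r t with ⟨w, hw, rfl⟩ | ⟨z, rfl⟩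
  swap
  · exact hfr.exists_eq_mul_right hε.toIsPresentedBy hst
  have hwa : w * a ≠ 0 := mul_ne_zero (fun hw0 => hε.ne_zero (by simpa [hw0] using hfr.comm))
    hε.ne_zero
  obtain ⟨x, -, u, hxu⟩ := hR.exists_eq_mul_mul_unit hε.mem_jacobson hε.ne_zero
    (Ideal.mul_mem_left _ w hε.mem_jacobson) hwa
  have comm : x * w * a = a * ↑u⁻¹ := by
    rw [Units.eq_mul_inv_iff_mul_eq, mul_assoc x, ← hxu]
  obtain ⟨b, hb⟩ := hε.exists_end_represents comm
  obtain ⟨y, hy⟩ := hfr.exists_eq_mul_right hε.toIsPresentedBy (mul_assoc x w t ▸ hb.mul hst)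
  obtain ⟨e, he, heI, hse⟩ := hX.exists_exact_right hR hs0 hs
  obtain ⟨v, hv⟩ := hX.isUnit_add hR ((hb.injective_iff hR hε).2 (Units.isUnit _))
    (fun h => hR.mem_jacobson_iff.1 (Ideal.mul_mem_left _ x hw)
      ((hb.surjective_iff hR hε).1 h)) he heI
  have hes : e * s = 0 := hse.linearMap_comp_eq_zero
  exact ⟨↑v⁻¹ * y, by
    rw [mul_assoc, ← hy, Units.eq_inv_mul_iff_mul_eq, hv, add_mul, hes, add_zero]⟩

theorem exists_eq_surjective_mul (hX : IsCyclicallyPresentedTorsion R X)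
    (hR : IsNearlySimpleUniserialDomain R) {g s : Module.End Rᵐᵒᵖ X}
    (hg : Function.Surjective g) (hs : ¬ Function.Injective s) : ∃ y, s = g * y := by
  have := hR.isDomain
  by_cases hs0 : s = 0
  · exact ⟨0, by simp [hs0]⟩
  obtain ⟨ε, a, hε⟩ := hX.exists_isTorsionPresentation
  obtain ⟨r, r', hgr⟩ := hε.exists_represents g
  obtain ⟨r, rfl⟩ := (hgr.surjective_iff hR hε).1 hg
  obtain ⟨t, t', hst⟩ := hε.exists_represents s
  rcases hR.exists_mem_jacobson_eq_mul_or' r' t' with ⟨w, hw, rfl⟩ | ⟨z, rfl⟩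
  swap
  · exact hgr.exists_eq_mul_left hε.toIsPresentedBy hst
  have haw : a * w ≠ 0 := mul_ne_zero hε.ne_zero
    (fun hw0 => hε.ne_zero (by simpa [hw0] using hgr.comm))
  obtain ⟨u, x, -, hux⟩ := hR.exists_eq_unit_mul_mul hε.mem_jacobson hε.ne_zero
    (Ideal.mul_mem_right w _ hε.mem_jacobson) haw
  have comm : ↑u⁻¹ * a = a * (w * x) := by
    rw [Units.inv_mul_eq_iff_eq_mul, ← mul_assoc a, ← mul_assoc, ← hux]
  obtain ⟨b, hb⟩ := hε.exists_end_represents comm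
  obtain ⟨y, hy⟩ := hgr.exists_eq_mul_left hε.toIsPresentedBy ((mul_assoc t' w x).symm ▸ hst.mul hb)
  obtain ⟨e, he, heK, hes⟩ := hX.exists_exact_left hR hs0 hs
  obtain ⟨v, hv⟩ := hX.isUnit_add hR he heK ((hb.surjective_iff hR hε).2 (Units.isUnit _))
    (fun h => hR.mem_jacobson_iff.1 (Ideal.mul_mem_right x _ hw) ((hb.injective_iff hR hε).1 h))
  have hse : s * e = 0 := hes.linearMap_comp_eq_zero
  exact ⟨y * ↑v⁻¹, by
    rw [← mul_assoc, ← hy, Units.eq_mul_inv_iff_mul_eq, hv, mul_add, hse, zero_add]⟩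

theorem exists_isShortExact (hX : IsCyclicallyPresentedTorsion R X)
    (hR : IsNearlySimpleUniserialDomain R) : ∃ f g : Module.End Rᵐᵒᵖ X, IsShortExact f g := by
  have := hX.nontrivial hR
  obtain ⟨f, hf, hf'⟩ := hX.exists_injective_not_surjective hR
  have hf0 : f ≠ 0 := by
    rintro rfl
    exact not_subsingleton X ⟨fun _ _ => hf rfl⟩
  obtain ⟨g, hg, -, hfg⟩ := hX.exists_exact_right hR hf0 hf'
  exact ⟨f, g, hf, hfg, hg⟩

end IsCyclicallyPresentedTorsion

section Pairs

variable {S : Type u} [Ring S]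

/-- `f` and `g` are weak kernel and weak cokernel of each other, as in a short exact sequence
`0 → X → X → X → 0` of endomorphisms of a module `X` with enough liftings. -/
structure IsExactPair (f g : S) : Prop where
  mul_eq_zero : g * f = 0
  exists_eq_mul_right : ∀ t, t * f = 0 → ∃ y, t = y * g
  exists_eq_mul_left : ∀ t, g * t = 0 → ∃ y, t = f * y

/-- The arithmetic of the endomorphism ring `S` of `R / a R`, expressed through the ideal `I` of
non-monomorphisms and the ideal `K` of non-epimorphisms. -/
structure IsDubrovinPuninskiPair (I K : Ideal S) : Prop where
  isTwoSided_I : I.IsTwoSided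
  isTwoSided_K : K.IsTwoSided
  ne_top_I : I ≠ ⊤
  ne_top_K : K ≠ ⊤
  mul_notMem_I : ∀ s t, s ∉ I → t ∉ I → s * t ∉ I
  mul_notMem_K : ∀ s t, s ∉ K → t ∉ K → s * t ∉ K
  isUnit : ∀ s, s ∉ I → s ∉ K → IsUnit s
  exists_eq_mul : ∀ s, s ≠ 0 → ∃ f g, f ∉ I ∧ g ∉ K ∧ s = f * g
  isLeftRegular : ∀ f ∉ I, IsLeftRegular f
  isRightRegular : ∀ g ∉ K, IsRightRegular g
  exists_eq_mul_right : ∀ f ∉ I, ∀ s ∈ K, ∃ y, s = y * f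
  exists_eq_mul_left : ∀ g ∉ K, ∀ s ∈ I, ∃ y, s = g * y
  exists_isExactPair_left : ∀ g ∈ I, g ∉ K → ∃ f ∈ K, f ∉ I ∧ IsExactPair f g
  exists_isExactPair_right : ∀ f ∈ K, f ∉ I → ∃ g ∈ I, g ∉ K ∧ IsExactPair f g
  comparable : ∀ g h, g ∉ K → h ∉ K → (∃ y, g = y * h) ∨ ∃ y, h = y * g
  exists_mem_K_notMem_I : ∃ f ∈ K, f ∉ I

end Pairs

section EndomorphismRing

variable {R : Type u} [Ring R] {X : Type v} [AddCommGroup X] [Module Rᵐᵒᵖ X]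
  (hR : IsNearlySimpleUniserialDomain R) (hX : IsCyclicallyPresentedTorsion R X)

variable {hR hX} in
theorem notMem_idealI_iff {s : Module.End Rᵐᵒᵖ X} : s ∉ idealI hR hX ↔ Function.Injective s :=
  not_not

variable {hR hX} in
theorem notMem_idealK_iff {s : Module.End Rᵐᵒᵖ X} : s ∉ idealK hR hX ↔ Function.Surjective s :=
  not_not

theorem idealI_isTwoSided : (idealI hR hX).IsTwoSided where
  mul_mem_of_left {s} t hs h := by
    have hs : LinearMap.ker s ≠ ⊥ := fun e => hs (LinearMap.ker_eq_bot.1 e)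
    obtain ⟨y, hy, hy0⟩ := (Submodule.ne_bot_iff _).1 hs
    rcases hX.isUniserial hR (LinearMap.ker s) (LinearMap.range t) with h' | h'
    · obtain ⟨z, rfl⟩ := h' hy
      have hz : z = 0 := h (hy.trans (map_zero _).symm)
      exact hy0 (by rw [hz, map_zero])
    · have := hX.nontrivial hR
      obtain ⟨x, hx⟩ := exists_ne (0 : X)
      have hx' : s (t x) = 0 := h' ⟨x, rfl⟩
      exact hx (h (hx'.trans (map_zero _).symm))

theorem idealK_isTwoSided : (idealK hR hX).IsTwoSided where
  mul_mem_of_left t hs h := hs (Function.Surjective.of_comp (g := t) h)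

variable {hR hX} in
theorem isUnit_of_notMem_ideal {s : Module.End Rᵐᵒᵖ X} (hI : s ∉ idealI hR hX)
    (hK : s ∉ idealK hR hX) : IsUnit s :=
  (Module.End.isUnit_iff s).2 ⟨notMem_idealI_iff.1 hI, notMem_idealK_iff.1 hK⟩

theorem isLeftRegular_of_injective {f : Module.End Rᵐᵒᵖ X} (hf : Function.Injective f) :
    IsLeftRegular f := fun s t h => by
  ext x
  exact hf (LinearMap.congr_fun h x)

theorem isRightRegular_of_surjective {g : Module.End Rᵐᵒᵖ X} (hg : Function.Surjective g) :
    IsRightRegular g := fun s t h => by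
  ext x
  obtain ⟨y, rfl⟩ := hg x
  exact LinearMap.congr_fun h y

theorem IsShortExact.isExactPair {f g : Module.End Rᵐᵒᵖ X} (h : IsShortExact f g) :
    IsExactPair f g where
  mul_eq_zero := h.2.1.linearMap_comp_eq_zero
  exists_eq_mul_right t ht := by
    obtain ⟨y, hy⟩ := exists_comp_eq_of_ker_le h.2.2 (t := t)
      (h.2.1.linearMap_ker_eq ▸ LinearMap.range_le_ker_iff.2 ht)
    exact ⟨y, hy.symm⟩
  exists_eq_mul_left t ht := by
    obtain ⟨y, hy⟩ := exists_comp_eq_of_range_le h.1 (t := t)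
      (h.2.1.linearMap_ker_eq ▸ LinearMap.range_le_ker_iff.2 ht)
    exact ⟨y, hy.symm⟩

theorem isDubrovinPuninskiPair : IsDubrovinPuninskiPair (idealI hR hX) (idealK hR hX) where
  isTwoSided_I := idealI_isTwoSided hR hX
  isTwoSided_K := idealK_isTwoSided hR hX
  ne_top_I := (Ideal.ne_top_iff_one _).2 fun h => h Function.injective_id
  ne_top_K := (Ideal.ne_top_iff_one _).2 fun h => h Function.surjective_id
  mul_notMem_I _ _ hs ht :=
    notMem_idealI_iff.2 ((notMem_idealI_iff.1 hs).comp (notMem_idealI_iff.1 ht))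
  mul_notMem_K _ _ hs ht :=
    notMem_idealK_iff.2 ((notMem_idealK_iff.1 hs).comp (notMem_idealK_iff.1 ht))
  isUnit _ := isUnit_of_notMem_ideal
  exists_eq_mul _ hs := by
    obtain ⟨f, g, hf, hg, h⟩ := hX.exists_eq_injective_mul_surjective hR hs
    exact ⟨f, g, notMem_idealI_iff.2 hf, notMem_idealK_iff.2 hg, h⟩
  isLeftRegular _ hf := isLeftRegular_of_injective (notMem_idealI_iff.1 hf)
  isRightRegular _ hg := isRightRegular_of_surjective (notMem_idealK_iff.1 hg)
  exists_eq_mul_right _ hf _ hs := hX.exists_eq_mul_injective hR (notMem_idealI_iff.1 hf) hs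
  exists_eq_mul_left _ hg _ hs := hX.exists_eq_surjective_mul hR (notMem_idealK_iff.1 hg) hs
  exists_isExactPair_left g hg hg' := by
    obtain ⟨f, hf, hf', hfg⟩ := hX.exists_exact_left hR
      (fun h0 : g = 0 => hg' (h0 ▸ zero_mem _)) hg
    have h : IsShortExact f g := ⟨hf, hfg, notMem_idealK_iff.1 hg'⟩
    exact ⟨f, hf', notMem_idealI_iff.2 hf, h.isExactPair⟩
  exists_isExactPair_right f hf hf' := by
    obtain ⟨g, hg, hg', hfg⟩ := hX.exists_exact_right hR
      (fun h0 : f = 0 => hf' (h0 ▸ zero_mem _)) hf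
    have h : IsShortExact f g := ⟨notMem_idealI_iff.1 hf', hfg, hg⟩
    exact ⟨g, hg', notMem_idealK_iff.2 hg, h.isExactPair⟩
  comparable g h hg hh := by
    rcases hX.isUniserial hR (LinearMap.ker g) (LinearMap.ker h) with h' | h'
    · obtain ⟨y, hy⟩ := exists_comp_eq_of_ker_le (notMem_idealK_iff.1 hg) h'
      exact Or.inr ⟨y, hy.symm⟩
    · obtain ⟨y, hy⟩ := exists_comp_eq_of_ker_le (notMem_idealK_iff.1 hh) h'
      exact Or.inl ⟨y, hy.symm⟩
  exists_mem_K_notMem_I := by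
    obtain ⟨f, hf, hf'⟩ := hX.exists_injective_not_surjective hR
    exact ⟨f, hf', notMem_idealI_iff.2 hf⟩

namespace IsShortExact

variable {f g : Module.End Rᵐᵒᵖ X}

theorem left_notMem_I (h : IsShortExact f g) : f ∉ idealI hR hX :=
  notMem_idealI_iff.2 h.1

theorem right_notMem_K (h : IsShortExact f g) : g ∉ idealK hR hX :=
  notMem_idealK_iff.2 h.2.2

theorem left_mem_K (h : IsShortExact f g) : f ∈ idealK hR hX := by
  by_contra hf
  have hg : g = 0 := isRightRegular_of_surjective (notMem_idealK_iff.1 hf)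
    (h.isExactPair.mul_eq_zero.trans (zero_mul f).symm)
  exact h.right_notMem_K hR hX (hg ▸ zero_mem _)

theorem right_mem_I (h : IsShortExact f g) : g ∈ idealI hR hX := by
  by_contra hg
  have hf : f = 0 := isLeftRegular_of_injective (notMem_idealI_iff.1 hg)
    (h.isExactPair.mul_eq_zero.trans (mul_zero g).symm)
  exact h.left_notMem_I hR hX (hf ▸ zero_mem _)

end IsShortExact

end EndomorphismRing

namespace IsDubrovinPuninskiPair

variable {S : Type u} [Ring S] {I K : Ideal S} {f g s t : S}

theorem mul_mem_I (h : IsDubrovinPuninskiPair I K) (hs : s ∈ I) (t : S) : s * t ∈ I :=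
  h.isTwoSided_I.mul_mem_of_left t hs

theorem mul_mem_K (h : IsDubrovinPuninskiPair I K) (hs : s ∈ K) (t : S) : s * t ∈ K :=
  h.isTwoSided_K.mul_mem_of_left t hs

theorem one_notMem_K (h : IsDubrovinPuninskiPair I K) : (1 : S) ∉ K :=
  (Ideal.ne_top_iff_one K).1 h.ne_top_K

theorem isUnit_add (h : IsDubrovinPuninskiPair I K) (hfK : f ∈ K) (hfI : f ∉ I) (hgI : g ∈ I)
    (hgK : g ∉ K) : IsUnit (f + g) :=
  isUnit_add_of_notMem h.isUnit hfK hfI hgI hgK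

theorem exists_mem_I_notMem_K (h : IsDubrovinPuninskiPair I K) : ∃ g ∈ I, g ∉ K := by
  obtain ⟨f, hf, hf'⟩ := h.exists_mem_K_notMem_I
  obtain ⟨g, hg, hg', -⟩ := h.exists_isExactPair_right f hf hf'
  exact ⟨g, hg, hg'⟩

theorem exists_mul_add_mul_eq_one (h : IsDubrovinPuninskiPair I K) (hf : f ∉ I) (hg : g ∉ K) :
    ∃ a b, a * f + b * g = 1 := by
  by_cases hfK : f ∈ K
  · by_cases hgI : g ∈ I
    · obtain ⟨u, hu⟩ := h.isUnit_add hfK hf hgI hg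
      exact ⟨↑u⁻¹, ↑u⁻¹, by rw [← mul_add, ← hu, Units.inv_mul]⟩
    · obtain ⟨u, rfl⟩ := h.isUnit g hgI hg
      exact ⟨0, ↑u⁻¹, by rw [zero_mul, zero_add, Units.inv_mul]⟩
  · obtain ⟨u, rfl⟩ := h.isUnit f hf hfK
    exact ⟨↑u⁻¹, 0, by rw [zero_mul, add_zero, Units.inv_mul]⟩

theorem exists_sub_mul_mem_I (h : IsDubrovinPuninskiPair I K) (ht : t ∉ I) :
    ∃ y, 1 - y * t ∈ I := by
  obtain ⟨g, hgI, hgK⟩ := h.exists_mem_I_notMem_K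
  obtain ⟨a, b, hab⟩ := h.exists_mul_add_mul_eq_one ht hgK
  exact ⟨a, by rw [← hab, add_sub_cancel_left]; exact I.mul_mem_left b hgI⟩

theorem exists_mem_I_sub_mul_mem_K (h : IsDubrovinPuninskiPair I K) (ht : t ∉ K) :
    ∃ z ∈ I, 1 - z * t ∈ K := by
  obtain ⟨g, hgI, hgK⟩ := h.exists_mem_I_notMem_K
  obtain ⟨f, hfK, hfI⟩ := h.exists_mem_K_notMem_I
  obtain ⟨a, b, hab⟩ := h.exists_mul_add_mul_eq_one hfI (h.mul_notMem_K g t hgK ht)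
  refine ⟨b * g, I.mul_mem_left b hgI, ?_⟩
  rw [← hab, mul_assoc, add_sub_cancel_right]
  exact K.mul_mem_left a hfK

theorem isSimpleModule_quotient (h : IsDubrovinPuninskiPair I K) : IsSimpleModule S (S ⧸ I) := by
  refine isSimpleModule_iff_isCoatom.2 ⟨h.ne_top_I, fun L hL => ?_⟩
  obtain ⟨t, htL, htI⟩ := SetLike.exists_of_lt hL
  obtain ⟨y, hy⟩ := h.exists_sub_mul_mem_I htI
  exact (Ideal.eq_top_iff_one L).2
    ((L.sub_mem_iff_left (L.smul_mem y htL)).1 (hL.le hy))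

theorem exists_mem_I_eq_mul (h : IsDubrovinPuninskiPair I K) (hg : g ∉ K) (hs : s ∈ I) :
    ∃ v ∈ I, s = g * v := by
  obtain ⟨v, hv⟩ := h.exists_eq_mul_left g hg s hs
  by_cases hgI : g ∈ I
  · obtain ⟨f, hfK, hfI, hfg⟩ := h.exists_isExactPair_left g hgI hg
    obtain ⟨u, hu⟩ := h.isUnit_add hfK hfI hgI hg
    refine ⟨g * (↑u⁻¹ * v), h.mul_mem_I hgI _, ?_⟩
    have hv' : g * (↑u⁻¹ * v) = v - f * (↑u⁻¹ * v) := by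
      rw [eq_sub_iff_add_eq, add_comm, ← add_mul, ← hu, Units.mul_inv_cancel_left]
    rw [hv', mul_sub, ← mul_assoc g f, hfg.mul_eq_zero, zero_mul, sub_zero, hv]
  · obtain ⟨u, rfl⟩ := h.isUnit g hgI hg
    exact ⟨↑u⁻¹ * s, I.mul_mem_left _ hs, by rw [Units.mul_inv_cancel_left]⟩

theorem exists_mem_inf_eq_mul (h : IsDubrovinPuninskiPair I K) (hfK : f ∈ K) (hfI : f ∉ I)
    (hs : s ∈ I ⊓ K) : ∃ v ∈ I ⊓ K, s = v * f := by
  obtain ⟨v, hv⟩ := h.exists_eq_mul_right f hfI s hs.2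
  obtain ⟨g, hgI, hgK, hfg⟩ := h.exists_isExactPair_right f hfK hfI
  obtain ⟨u, hu⟩ := h.isUnit_add hfK hfI hgI hgK
  have hv' : v * ↑u⁻¹ * f = v - v * ↑u⁻¹ * g := by
    rw [eq_sub_iff_add_eq, ← mul_add, ← hu, Units.inv_mul_cancel_right]
  have hsf : s = v * ↑u⁻¹ * f * f := by
    rw [hv', sub_mul, mul_assoc _ g f, hfg.mul_eq_zero, mul_zero, sub_zero, hv]
  refine ⟨v * ↑u⁻¹ * f, ⟨?_, K.mul_mem_left _ hfK⟩, hsf⟩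
  by_contra hI
  exact h.mul_notMem_I _ _ hI hfI (hsf ▸ hs.1)

theorem mem_I_of_mul_mem (h : IsDubrovinPuninskiPair I K) (hf : f ∉ I) (hs : f * s ∈ I) :
    s ∈ I := by
  by_contra h'
  exact h.mul_notMem_I _ _ hf h' hs

theorem notMem_of_mul_notMem_K (h : IsDubrovinPuninskiPair I K) (hst : s * t ∉ K) : s ∉ K :=
  fun hs => hst (h.mul_mem_K hs t)

/-- A kernel `f` of `s` is strictly larger than `f ^ 2`, so its cokernel factors properly through
that of `f ^ 2`. -/
theorem exists_notMem_K_mem_I_eq_mul_of_notMem_K (h : IsDubrovinPuninskiPair I K) (hsI : s ∈ I)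
    (hsK : s ∉ K) : ∃ t ∈ I, t ∉ K ∧ ∃ y ∈ I, s = y * t := by
  obtain ⟨f, hfK, hfI, hfs⟩ := h.exists_isExactPair_left s hsI hsK
  obtain ⟨t, htI, htK, hft⟩ :=
    h.exists_isExactPair_right (f * f) (K.mul_mem_left _ hfK) (h.mul_notMem_I _ _ hfI hfI)
  obtain ⟨y, rfl⟩ := hft.exists_eq_mul_right s
    (by rw [← mul_assoc, hfs.mul_eq_zero, zero_mul])
  refine ⟨t, htI, htK, y, ?_, rfl⟩
  by_contra hyI
  have htf : t * f = 0 := h.isLeftRegular y hyI (by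
    simp only [← mul_assoc, hfs.mul_eq_zero, mul_zero])
  obtain ⟨w, hw⟩ := hft.exists_eq_mul_left f htf
  have hfw : f * w = 1 := h.isLeftRegular f hfI (by simp only [← mul_assoc, ← hw, mul_one])
  exact h.one_notMem_K (hfw ▸ h.mul_mem_K hfK w)

theorem exists_notMem_K_mem_I_eq_mul (h : IsDubrovinPuninskiPair I K) (hs : s ∈ I) :
    ∃ t ∈ I, t ∉ K ∧ ∃ y ∈ I, s = y * t := by
  by_cases hs0 : s = 0
  · obtain ⟨t, htI, htK⟩ := h.exists_mem_I_notMem_K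
    exact ⟨t, htI, htK, 0, zero_mem _, by rw [hs0, zero_mul]⟩
  obtain ⟨f, g, hf, hg, rfl⟩ := h.exists_eq_mul s hs0
  obtain ⟨t, htI, htK, y, hy, rfl⟩ :=
    h.exists_notMem_K_mem_I_eq_mul_of_notMem_K (h.mem_I_of_mul_mem hf hs) hg
  exact ⟨t, htI, htK, f * y, I.mul_mem_left _ hy, (mul_assoc _ _ _).symm⟩

theorem exists_common_notMem_K_mem_I_eq_mul (h : IsDubrovinPuninskiPair I K) (hs : s ∈ I)
    (ht : t ∈ I) : ∃ e ∈ I, e ∉ K ∧ (∃ y ∈ I, s = y * e) ∧ ∃ y ∈ I, t = y * e := by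
  obtain ⟨e, heI, heK, y, hy, rfl⟩ := h.exists_notMem_K_mem_I_eq_mul hs
  obtain ⟨e', heI', heK', y', hy', rfl⟩ := h.exists_notMem_K_mem_I_eq_mul ht
  rcases h.comparable e e' heK heK' with ⟨z, rfl⟩ | ⟨z, rfl⟩
  · exact ⟨e', heI', heK', ⟨y * z, h.mul_mem_I hy z, (mul_assoc _ _ _).symm⟩, y', hy', rfl⟩
  · exact ⟨e, heI, heK, ⟨y, hy, rfl⟩, y' * z, h.mul_mem_I hy' z, (mul_assoc _ _ _).symm⟩

/-- Write `s = f g` and `t = f' g'` with monomorphisms `f, f'` and epimorphisms `g, g'`; one of `g,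
g'` is a multiple of the other. -/
theorem symmetric_induction (h : IsDubrovinPuninskiPair I K) {P : S → S → Prop}
    (symm : ∀ s t, P s t → P t s) (zero : ∀ t, P 0 t)
    (mul : ∀ f c g, f ∉ I → g ∉ K → P (f * g) (c * g)) (s t : S) : P s t := by
  by_cases hs : s = 0
  · exact hs ▸ zero t
  by_cases ht : t = 0
  · exact symm _ _ (ht ▸ zero s)
  obtain ⟨f, g, hf, hg, rfl⟩ := h.exists_eq_mul s hs
  obtain ⟨f', g', hf', hg', rfl⟩ := h.exists_eq_mul t ht
  rcases h.comparable g g' hg hg' with ⟨z, rfl⟩ | ⟨z, rfl⟩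
  · exact symm _ _ (mul_assoc f z g' ▸ mul f' (f * z) g' hf' hg')
  · exact mul_assoc f' z g ▸ mul f (f' * z) g hf hg

theorem exists_annihilator (h : IsDubrovinPuninskiPair I K) (d : S) :
    ∃ e, ∀ t, t * d = 0 ↔ ∃ y, t = y * e := by
  by_cases hd : d = 0
  · exact ⟨1, fun t => ⟨fun _ => ⟨t, (mul_one t).symm⟩, fun _ => by rw [hd, mul_zero]⟩⟩
  obtain ⟨f, k, hf, hk, rfl⟩ := h.exists_eq_mul d hd
  have hfk : ∀ t, t * (f * k) = 0 ↔ t * f = 0 := fun t => by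
    rw [← mul_assoc]
    exact (h.isRightRegular k hk).eq_iff' (zero_mul k)
  by_cases hfK : f ∈ K
  · obtain ⟨e, -, -, hfe⟩ := h.exists_isExactPair_right f hfK hf
    refine ⟨e, fun t => (hfk t).trans ⟨hfe.exists_eq_mul_right t, ?_⟩⟩
    rintro ⟨y, rfl⟩
    rw [mul_assoc, hfe.mul_eq_zero, mul_zero]
  · refine ⟨0, fun t => (hfk t).trans (((h.isRightRegular f hfK).eq_iff' (zero_mul f)).trans ?_)⟩
    simp only [mul_zero, exists_const]

theorem isPrincipal_span_pair (h : IsDubrovinPuninskiPair I K) :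
    ∀ s t : S, (Ideal.span {s, t}).IsPrincipal := by
  refine h.symmetric_induction (fun s t hst => ?_) (fun t => ?_) fun f c g hf _ => ?_
  · rwa [Set.pair_comm]
  · rw [Ideal.span_insert_zero]
    exact ⟨t, rfl⟩
  by_cases hc : c ∈ K
  · obtain ⟨y, rfl⟩ := h.exists_eq_mul_right f hf c hc
    refine ⟨f * g, le_antisymm (Ideal.span_le.2 ?_) (Ideal.span_mono (by simp))⟩
    rintro _ (rfl | rfl)
    · exact Ideal.mem_span_singleton_self _
    · exact Ideal.mem_span_singleton'.2 ⟨y, (mul_assoc _ _ _).symm⟩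
  · obtain ⟨a, b, hab⟩ := h.exists_mul_add_mul_eq_one hf hc
    refine ⟨g, le_antisymm (Ideal.span_le.2 ?_) (Ideal.span_le.2 ?_)⟩
    · rintro _ (rfl | rfl)
      · exact Ideal.mem_span_singleton'.2 ⟨f, rfl⟩
      · exact Ideal.mem_span_singleton'.2 ⟨c, rfl⟩
    · rintro _ rfl
      exact Ideal.mem_span_pair.2
        ⟨a, b, by rw [← mul_assoc, ← mul_assoc, ← add_mul, hab, one_mul]⟩

theorem isBezout (h : IsDubrovinPuninskiPair I K) : IsBezout S where
  isPrincipal_of_FG L hL := by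
    refine Submodule.fg_induction (motive := fun L _ => L.IsPrincipal) (fun x => ⟨x, rfl⟩) ?_ L hL
    rintro _ _ _ _ ⟨s, rfl⟩ ⟨t, rfl⟩
    rw [← Submodule.span_union, Set.singleton_union]
    exact h.isPrincipal_span_pair s t

theorem exists_sub_mul_eq_mul (h : IsDubrovinPuninskiPair I K) (hg : g ∉ K) (ht : t ∉ K) :
    ∃ z ∈ I, ∃ k ∈ K, t - z * g = k * t := by
  have of_eq_mul : ∀ y, g = y * t → ∃ z ∈ I, ∃ k ∈ K, t - z * g = k * t := by
    rintro y rfl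
    obtain ⟨z, hz, hzK⟩ := h.exists_mem_I_sub_mul_mem_K (h.notMem_of_mul_notMem_K hg)
    exact ⟨z, hz, _, hzK, by rw [sub_mul, one_mul, mul_assoc]⟩
  rcases h.comparable g t hg ht with ⟨y, hy⟩ | ⟨y, rfl⟩
  · exact of_eq_mul y hy
  · by_cases hyI : y ∈ I
    · exact ⟨y, hyI, 0, zero_mem _, by rw [sub_self, zero_mul]⟩
    · obtain ⟨u, rfl⟩ := h.isUnit y hyI (h.notMem_of_mul_notMem_K ht)
      exact of_eq_mul ↑u⁻¹ (Units.inv_mul_cancel_left u g).symm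

theorem comparable_mod (h : IsDubrovinPuninskiPair I K) (hg : g ∉ K) (s t : S) :
    (∃ x, ∃ z ∈ I, s - x * t = z * g) ∨ ∃ x, ∃ z ∈ I, t - x * s = z * g := by
  refine h.symmetric_induction
    (P := fun s t => (∃ x, ∃ z ∈ I, s - x * t = z * g) ∨ ∃ x, ∃ z ∈ I, t - x * s = z * g)
    (fun s t => Or.symm)
    (fun t => Or.inl ⟨0, 0, zero_mem _, by rw [zero_mul, zero_mul, sub_zero]⟩)
    (fun f c e hf he => Or.inr ?_) s t
  by_cases hc : c ∈ K
  · obtain ⟨y, rfl⟩ := h.exists_eq_mul_right f hf c hc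
    exact ⟨y, 0, zero_mem _, by rw [mul_assoc, sub_self, zero_mul]⟩
  · obtain ⟨z, hz, k, hk, hzk⟩ := h.exists_sub_mul_eq_mul hg (h.mul_notMem_K c e hc he)
    obtain ⟨y, hy⟩ := h.exists_eq_mul_right f hf (k * c) (h.mul_mem_K hk c)
    refine ⟨y, z, hz, ?_⟩
    rw [← mul_assoc y, ← hy, mul_assoc, ← hzk, sub_sub_cancel]

end IsDubrovinPuninskiPair

section Uniserial

variable {S : Type u} [Ring S]

theorem isUniserial_of_comparable {M : Type v} [AddCommGroup M] [Module S M]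
    (h : ∀ x y : M, (∃ a : S, x = a • y) ∨ ∃ a : S, y = a • x) : IsUniserial S M := by
  intro N P
  by_contra! hNP
  obtain ⟨x, hx, hx'⟩ := SetLike.not_le_iff_exists.1 hNP.1
  obtain ⟨y, hy, hy'⟩ := SetLike.not_le_iff_exists.1 hNP.2
  rcases h x y with ⟨a, rfl⟩ | ⟨a, rfl⟩
  · exact hx' (P.smul_mem _ hy)
  · exact hy' (N.smul_mem _ hx)

/-- `l ∘ k` bijective splits `B` as `range k ⊕ ker l`, and one summand contains the other. -/
theorem IsUniserial.surjective_of_bijective_comp {A B C : Type*} [AddCommGroup A] [Module S A]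
    [AddCommGroup B] [Module S B] [AddCommGroup C] [Module S C] [Nontrivial A]
    (hB : IsUniserial S B) {k : A →ₗ[S] B} {l : B →ₗ[S] C} (h : Function.Bijective (l ∘ₗ k)) :
    Function.Surjective k := by
  intro b
  obtain ⟨a, ha⟩ := h.2 (l b)
  have hker : b - k a ∈ LinearMap.ker l := by
    rw [LinearMap.mem_ker, map_sub, ← ha, LinearMap.comp_apply, sub_self]
  rcases hB (LinearMap.ker l) (LinearMap.range k) with hle | hle
  · obtain ⟨a', ha'⟩ := hle hker
    exact ⟨a' + a, by rw [map_add, ha', sub_add_cancel]⟩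
  · obtain ⟨x, hx⟩ := exists_ne (0 : A)
    exact absurd (h.1 ((hle ⟨x, rfl⟩ : l (k x) = 0).trans (map_zero (l ∘ₗ k)).symm)) hx

theorem socle_eq_of_isSimpleModule {M : Type v} [AddCommGroup M] [Module S M] {N : Submodule S M}
    (hM : IsUniserial S M) (hN : IsSimpleModule S N) : socle S M = N := by
  refine le_antisymm (sSup_le fun P (hP : IsSimpleModule S P) => ?_) (le_sSup hN)
  rw [isSimpleModule_iff_isAtom] at hN hP
  rcases hM P N with h | h
  · exact h
  · exact ((hP.le_iff_eq hN.1).1 h).ge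

end Uniserial

section Flat

variable {S : Type u} [Ring S] {M : Type v} [AddCommGroup M] [Module S M]

/-- The character module of a left module as a right module, `(χ s) m = χ (s m)`. -/
instance characterModuleRight : Module Sᵐᵒᵖ (CharacterModule M) :=
  inferInstanceAs (Module Sᵈᵐᵃ (M →+ AddCircle (1 : ℚ)))

theorem op_smul_character_apply (χ : CharacterModule M) (s : S) (m : M) :
    (op s • χ) m = χ (s • m) :=
  rfl

variable {N : Type w} [AddCommGroup N] [Module Sᵐᵒᵖ N]

/-- Tensor-hom adjunction: a character of `N ⊗ M` as a morphism from `N` to the characters of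
`M`. -/
def characterCurry (χ : CharacterModule (BalancedTensor S N M)) :
    N →ₗ[Sᵐᵒᵖ] CharacterModule M where
  toFun n := χ.comp ((balancedRel S N M).mkQ ∘ₗ TensorProduct.mk ℤ N M n).toAddMonoidHom
  map_add' n n' := DFunLike.ext _ _ fun m =>
    (congrArg (fun z => χ ((balancedRel S N M).mkQ z)) (TensorProduct.add_tmul n n' m)).trans
      (map_add (χ.comp (balancedRel S N M).mkQ.toAddMonoidHom) _ _)
  map_smul' s n := DFunLike.ext _ _ fun m =>
    congrArg χ ((Submodule.Quotient.eq _).2 (Submodule.subset_span ⟨n, s.unop, m, rfl⟩))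

/-- Tensor-hom adjunction: a morphism from `N` to the characters of `M` as a character of
`N ⊗ M`. -/
def characterUncurry (ψ : N →ₗ[Sᵐᵒᵖ] CharacterModule M) :
    BalancedTensor S N M →ₗ[ℤ] AddCircle (1 : ℚ) :=
  (balancedRel S N M).liftQ
    (TensorProduct.liftAddHom ψ.toAddMonoidHom fun k n m =>
      (DFunLike.congr_fun (map_zsmul ψ k n) m).trans
        (map_zsmul (ψ n) k m).symm).toIntLinearMap <| by
    refine Submodule.span_le.2 ?_
    rintro _ ⟨n, s, m, rfl⟩
    exact LinearMap.sub_mem_ker_iff.2 (DFunLike.congr_fun (ψ.map_smul (op s) n) m)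

theorem isFlat_of_baer (h : Module.Baer Sᵐᵒᵖ (CharacterModule M)) : IsFlat S M := by
  intro N N' _ _ _ _ φ hφ
  refine (injective_iff_map_eq_zero _).2 fun z hz =>
    CharacterModule.eq_zero_of_character_apply fun χ => ?_
  obtain ⟨ψ, hψ⟩ := h.extension_property φ hφ (characterCurry χ)
  have hχ : χ.toIntLinearMap = characterUncurry ψ ∘ₗ balancedMap S φ M := by
    ext n m
    exact (DFunLike.congr_fun (LinearMap.congr_fun hψ n) m).symm
  exact (LinearMap.congr_fun hχ z).trans (by rw [LinearMap.comp_apply, hz, map_zero])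

/-- Any two elements lie in a common cyclic submodule. -/
def IsLocallyCyclic (S : Type u) [Ring S] (M : Type v) [AddCommGroup M] [Module S M] : Prop :=
  ∀ x y : M, ∃ (p : M) (a b : S), x = a • p ∧ y = b • p

/-- Every relation `d p = 0` is explained by a factorization `p = b p'` with `d b = 0`. -/
def LiftsAnnihilators (S : Type u) [Ring S] (M : Type v) [AddCommGroup M] [Module S M] : Prop :=
  ∀ (d : S) (p : M), d • p = 0 → ∃ (b : S) (p' : M), p = b • p' ∧ d * b = 0

/-- The multiplication map `D ⊗ M → M` of a right ideal `D`. -/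
def rightIdealMul (M : Type v) [AddCommGroup M] [Module S M] (D : Ideal Sᵐᵒᵖ) :
    D ⊗[ℤ] M →+ M :=
  TensorProduct.liftAddHom ((smulAddHom S M).comp
    ((MulOpposite.opAddEquiv (α := S)).symm.toAddMonoidHom.comp D.subtype.toAddMonoidHom))
    fun k d m => (smul_assoc k d.1.unop m).trans (smul_comm k d.1.unop m)

/-- The pairing `D ⊗ M → ℚ/ℤ` given by a morphism from a right ideal `D` to the characters of
`M`. -/
def rightIdealPairing {D : Ideal Sᵐᵒᵖ} (φ : D →ₗ[Sᵐᵒᵖ] CharacterModule M) :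
    D ⊗[ℤ] M →+ AddCircle (1 : ℚ) :=
  TensorProduct.liftAddHom φ.toAddMonoidHom fun k d m =>
    (DFunLike.congr_fun (map_zsmul φ k d) m).trans (map_zsmul (φ d) k m).symm

theorem IsLocallyCyclic.exists_rightIdealMul_eq (h : IsLocallyCyclic S M) {D : Ideal Sᵐᵒᵖ}
    (φ : D →ₗ[Sᵐᵒᵖ] CharacterModule M) (z : D ⊗[ℤ] M) : ∃ (d : D) (p : M),
      rightIdealMul M D z = d.1.unop • p ∧ rightIdealPairing φ z = φ d p := by
  induction z using TensorProduct.induction_on with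
  | zero => exact ⟨0, 0, by simp, by simp⟩
  | tmul d m => exact ⟨d, m, rfl, rfl⟩
  | add z z' hz hz' =>
    obtain ⟨d, x, hx, hx'⟩ := hz
    obtain ⟨d', y, hy, hy'⟩ := hz'
    obtain ⟨p, a, b, rfl, rfl⟩ := h x y
    refine ⟨op a • d + op b • d', p, ?_, ?_⟩
    · rw [map_add, hx, hy, smul_smul, smul_smul, ← add_smul]
      rfl
    · rw [map_add, hx', hy', φ.map_add, φ.map_smul, φ.map_smul]
      rfl

/-- A morphism from a right ideal `D` to the characters of `M` pairs with `D M`, and this pairing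
extends to `M` because `ℚ/ℤ` is divisible. -/
theorem IsLocallyCyclic.baer_characterModule (h : IsLocallyCyclic S M)
    (hann : LiftsAnnihilators S M) : Module.Baer Sᵐᵒᵖ (CharacterModule M) := by
  intro D φ
  have hker : LinearMap.ker (rightIdealMul M D).toIntLinearMap.rangeRestrict ≤
      LinearMap.ker (rightIdealPairing φ).toIntLinearMap := by
    rw [LinearMap.ker_rangeRestrict]
    intro z hz
    obtain ⟨d, p, hd, hdφ⟩ := h.exists_rightIdealMul_eq φ z
    obtain ⟨b, p, rfl, hdb⟩ := hann _ p (hd.symm.trans hz)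
    have hbd : op b • d = 0 := Subtype.ext (MulOpposite.unop_injective hdb)
    change rightIdealPairing φ z = 0
    rw [hdφ, ← op_smul_character_apply, ← map_smul, hbd, map_zero]
    rfl
  obtain ⟨ξ, hξ⟩ := exists_comp_eq_of_ker_le (LinearMap.surjective_rangeRestrict _) hker
  obtain ⟨χ, hχ⟩ := (Module.Baer.of_divisible (AddCircle (1 : ℚ))).extension_property
    (Submodule.subtype _) (Submodule.subtype_injective _) ξ
  refine ⟨LinearMap.toSpanSingleton Sᵐᵒᵖ (CharacterModule M) χ.toAddMonoidHom, fun d hd => ?_⟩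
  ext m
  have hmul : χ (d.unop • m) =
      ξ ((rightIdealMul M D).toIntLinearMap.rangeRestrict (⟨d, hd⟩ ⊗ₜ m)) :=
    LinearMap.congr_fun hχ ⟨d.unop • m, ⟨d, hd⟩ ⊗ₜ m, rfl⟩
  exact hmul.trans (LinearMap.congr_fun hξ (⟨d, hd⟩ ⊗ₜ m))

theorem IsLocallyCyclic.isFlat (h : IsLocallyCyclic S M) (hann : LiftsAnnihilators S M) :
    IsFlat S M :=
  isFlat_of_baer (h.baer_characterModule hann)

end Flat

section AbsolutelyPure

variable {S : Type u} [Ring S]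

/-- Left coherence: every finitely generated left ideal is finitely presented. -/
def IsLeftCoherent (S : Type u) [Ring S] : Prop :=
  ∀ L : Ideal S, L.FG → Module.FinitePresentation S L

/-- Morphisms to `M` from finitely generated submodules of `F` extend to `F`. Absolutely pure
modules are those with this property for all `F = Sⁿ`. -/
def ExtendsTo (S : Type u) [Ring S] (M : Type v) [AddCommGroup M] [Module S M]
    (F : Type w) [AddCommGroup F] [Module S F] : Prop :=
  ∀ A : Submodule S F, A.FG → ∀ φ : A →ₗ[S] M, ∃ ψ : F →ₗ[S] M, ψ ∘ₗ A.subtype = φ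

theorem isLeftCoherent_of_exists_annihilator [IsBezout S]
    (h : ∀ d : S, ∃ e, ∀ t, t * d = 0 ↔ ∃ y, t = y * e) : IsLeftCoherent S := by
  intro L hL
  obtain ⟨d, rfl⟩ := IsBezout.isPrincipal_of_FG L hL
  obtain ⟨e, he⟩ := h d
  rw [← LinearMap.range_toSpanSingleton]
  refine Module.finitePresentation_of_surjective _ (LinearMap.surjective_rangeRestrict _) ?_
  have hker : LinearMap.ker (LinearMap.toSpanSingleton S S d) = Ideal.span {e} := by
    ext t
    exact (he t).trans
      ((exists_congr fun y => eq_comm).trans Ideal.mem_span_singleton'.symm)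
  rw [LinearMap.ker_rangeRestrict, hker]
  exact Submodule.fg_span_singleton e

namespace ExtendsTo

variable {M : Type v} [AddCommGroup M] [Module S M] {F : Type*} [AddCommGroup F] [Module S F]
  {E : Type*} [AddCommGroup E] [Module S E]

theorem exists_comp_eq (h : ExtendsTo S M F) {B : Type*} [AddCommGroup B] [Module S B]
    [Module.Finite S B] {j : B →ₗ[S] F} {φ : B →ₗ[S] M}
    (hj : LinearMap.ker j ≤ LinearMap.ker φ) : ∃ ψ : F →ₗ[S] M, ψ ∘ₗ j = φ := by
  obtain ⟨χ, hχ⟩ := exists_comp_eq_of_ker_le (LinearMap.surjective_rangeRestrict j)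
    (hj.trans' (LinearMap.ker_rangeRestrict j).le)
  obtain ⟨ψ, hψ⟩ := h _ (Module.Finite.iff_fg.1 (inferInstance : Module.Finite S j.range)) χ
  exact ⟨ψ, by rw [← hχ, ← hψ]; rfl⟩

theorem of_equiv (h : ExtendsTo S M F) (e : F ≃ₗ[S] E) : ExtendsTo S M E := by
  intro A hA φ
  have := Module.Finite.iff_fg.2 hA
  obtain ⟨ψ, hψ⟩ := h.exists_comp_eq (j := e.symm.toLinearMap ∘ₗ A.subtype) (φ := φ) <| by
    rw [LinearMap.ker_comp_of_ker_eq_bot _ e.symm.ker, Submodule.ker_subtype]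
    exact bot_le
  exact ⟨ψ ∘ₗ e.symm.toLinearMap, hψ⟩

/-- For `A ≤ E × F`, coherence makes `A ∩ F` finitely generated; a morphism on `A` corrected by an
extension of its restriction to `A ∩ F` factors through the projection to `E`. -/
theorem prod (hE : ∀ L : Submodule S E, L.FG → Module.FinitePresentation S L)
    (h : ExtendsTo S M E) (h' : ExtendsTo S M F) : ExtendsTo S M (E × F) := by
  intro A hA φ
  have := Module.Finite.iff_fg.2 hA
  let p := LinearMap.fst S E F ∘ₗ A.subtype
  let q := LinearMap.snd S E F ∘ₗ A.subtype
  have hp : (LinearMap.ker p).FG := by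
    have := hE _ (Module.Finite.iff_fg.1 (inferInstance : Module.Finite S p.range))
    rw [← LinearMap.ker_rangeRestrict]
    exact Module.FinitePresentation.fg_ker _ p.surjective_rangeRestrict
  have := Module.Finite.iff_fg.2 hp
  obtain ⟨ψ, hψ⟩ := h'.exists_comp_eq (B := LinearMap.ker p) (j := q ∘ₗ (LinearMap.ker p).subtype)
    (φ := φ ∘ₗ (LinearMap.ker p).subtype) fun x hx => by
      have hx0 : x.1 = 0 := Subtype.ext (Prod.ext x.2 hx)
      rw [LinearMap.mem_ker, LinearMap.comp_apply, Submodule.subtype_apply, hx0, map_zero]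
  obtain ⟨χ, hχ⟩ := h.exists_comp_eq (j := p) (φ := φ - ψ ∘ₗ q) fun x hx =>
    sub_eq_zero.2 (LinearMap.congr_fun hψ ⟨x, hx⟩).symm
  refine ⟨χ.coprod ψ, ?_⟩
  ext x
  exact (congrArg (· + ψ (q x)) (LinearMap.congr_fun hχ x)).trans (sub_add_cancel _ _)

theorem pi (hS : IsLeftCoherent S) (h : ExtendsTo S M S) (n : ℕ) :
    ExtendsTo S M (Fin n → S) := by
  induction n with
  | zero => exact fun A _ φ => ⟨0, LinearMap.ext fun a => by
      rw [Subsingleton.elim a 0, map_zero, map_zero]⟩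
  | succ n ih => exact (prod hS h ih).of_equiv (Fin.consLinearEquiv S (fun _ : Fin (n + 1) => S))

theorem of_isBezout [IsBezout S] (h : ∀ (d : S) (m : M), (∀ t, t * d = 0 → t • m = 0) →
    ∃ m', m = d • m') : ExtendsTo S M S := by
  intro L hL φ
  obtain ⟨d, rfl⟩ := IsBezout.isPrincipal_of_FG L hL
  have hd : d ∈ Ideal.span {d} := Ideal.mem_span_singleton_self d
  obtain ⟨m, hm⟩ := h d (φ ⟨d, hd⟩) fun t ht => by
    rw [← map_smul, show t • (⟨d, hd⟩ : Ideal.span {d}) = 0 from Subtype.ext ht, map_zero]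
  refine ⟨LinearMap.toSpanSingleton S M m, ?_⟩
  ext ⟨x, hx⟩
  obtain ⟨a, rfl⟩ := Ideal.mem_span_singleton'.1 hx
  exact (mul_smul a d m).trans
    ((congrArg (a • ·) hm.symm).trans (map_smul φ a ⟨d, hd⟩).symm)

end ExtendsTo

open CategoryTheory in
theorem isAbsolutelyPure_of_extendsTo {M : Type u} [AddCommGroup M] [Module S M]
    (h : ∀ n : ℕ, ExtendsTo S M (Fin n → S)) : IsAbsolutelyPure S M := by
  intro G _ _ hG
  have : HasExt.{u} (ModuleCat.{u} S) := hasExt_of_enoughProjectives (ModuleCat.{u} S)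
  obtain ⟨n, A, e, hA⟩ := Module.FinitePresentation.exists_fin S G
  let T : ShortComplex (ModuleCat.{u} S) :=
    .mk (ModuleCat.ofHom A.subtype) (ModuleCat.ofHom (e.symm.toLinearMap ∘ₗ A.mkQ)) <| by
      ext a
      simp
  have hT : T.ShortExact := by
    refine ModuleCat.shortComplex_shortExact T (fun x => ?_) A.subtype_injective
      (e.symm.surjective.comp A.mkQ_surjective)
    change e.symm (A.mkQ x) = 0 ↔ ∃ y, A.subtype y = x
    simp
  have hP : Projective T.X₂ := inferInstanceAs (Projective (ModuleCat.of S (Fin n → S)))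
  refine ⟨fun x y => ?_⟩
  suffices hExt : ∀ x : Abelian.Ext T.X₃ (ModuleCat.of S M) 1, x = 0 from
    (hExt x).trans (hExt y).symm
  intro x
  obtain ⟨x, rfl⟩ := Abelian.Ext.contravariant_sequence_exact₃ hT (ModuleCat.of S M) x
    (Abelian.Ext.eq_zero_of_projective _) (n₀ := 0) rfl
  obtain ⟨φ, rfl⟩ := Abelian.Ext.addEquiv₀.symm.surjective x
  obtain ⟨ψ, hψ⟩ := h n A hA φ.hom
  have hφ : T.f ≫ ModuleCat.ofHom ψ = φ := ModuleCat.hom_ext hψ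
  change hT.extClass.comp (Abelian.Ext.mk₀ φ) _ = 0
  rw [← hφ, ← Abelian.Ext.mk₀_comp_mk₀]
  exact hT.extClass_comp_assoc _

end AbsolutelyPure

section PureIdeal

variable {S : Type u} [Ring S]

theorem IsPure.exists_smul_eq {M : Type u} [AddCommGroup M] [Module S M] {N : Submodule S M}
    (h : IsPure N) {b : S} {x : M} (hbx : b • x ∈ N) : ∃ y ∈ N, b • y = b • x := by
  have hG : Module.FinitePresentation S (S ⧸ Ideal.span {b}) :=
    Module.finitePresentation_of_surjective (Ideal.span {b}).mkQ (Submodule.mkQ_surjective _) <| by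
      rw [Submodule.ker_mkQ]
      exact Submodule.fg_span_singleton b
  have hle : Ideal.span {b} ≤ LinearMap.ker (LinearMap.toSpanSingleton S (M ⧸ N) (N.mkQ x)) :=
    (Ideal.span_singleton_le_iff_mem _).2 ((Submodule.Quotient.mk_eq_zero N).2 hbx)
  obtain ⟨k, hk⟩ := h _ hG ((Ideal.span {b}).liftQ _ hle)
  let y := k ((Ideal.span {b}).mkQ 1)
  have hy : N.mkQ y = N.mkQ x := (LinearMap.congr_fun hk _).trans (one_smul S (N.mkQ x))
  have hby : b • y = 0 := by
    rw [← map_smul, ← map_smul, smul_eq_mul, mul_one, Submodule.mkQ_apply,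
      (Submodule.Quotient.mk_eq_zero _).2 (Ideal.mem_span_singleton_self b), map_zero]
  exact ⟨x - y, (Submodule.Quotient.eq N).1 hy.symm, by rw [smul_sub, hby, sub_zero]⟩

/-- A left ideal `L ≤ I` that is closed under solving equations `b y = c` solvable in `I`, together
with an epimorphism `g` in `L`. -/
structure IsPureEpiIdeal (I K L : Ideal S) (g : S) : Prop where
  le : L ≤ I
  mem : g ∈ L
  notMem : g ∉ K
  exists_mul_eq : ∀ b, ∀ x ∈ I, b * x ∈ L → ∃ y ∈ L, b * y = b * x

/-- The module `L / I g`. -/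
abbrev QuotMul (I L : Ideal S) (g : S) : Type u :=
  L ⧸ (Submodule.map (rightMul g) I).submoduleOf L

namespace QuotMul

variable {I K L : Ideal S} {g : S}

/-- The class of `t ∈ L` in `L / I g`. -/
def mk (I : Ideal S) {L : Ideal S} (g : S) {t : S} (ht : t ∈ L) : QuotMul I L g :=
  Submodule.Quotient.mk ⟨t, ht⟩

theorem exists_eq_mk (x : QuotMul I L g) : ∃ (t : S) (ht : t ∈ L), x = mk I g ht := by
  obtain ⟨⟨t, ht⟩, rfl⟩ := Submodule.mkQ_surjective _ x
  exact ⟨t, ht, rfl⟩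

theorem mk_eq_mk {s t : S} (hs : s ∈ L) (ht : t ∈ L) :
    mk I g hs = mk I g ht ↔ ∃ z ∈ I, s - t = z * g :=
  (Submodule.Quotient.eq _).trans (exists_congr fun _ => and_congr_right fun _ => eq_comm)

theorem mk_eq_zero {t : S} (ht : t ∈ L) : mk I g ht = 0 ↔ ∃ z ∈ I, t = z * g := by
  have := mk_eq_mk (I := I) (g := g) ht L.zero_mem
  rwa [sub_zero] at this

theorem exists_eq_smul_of_notMem (h : IsDubrovinPuninskiPair I K)
    (hL : IsPureEpiIdeal I K L g) {d : S} (hd : d ∉ K) (m : QuotMul I L g) : ∃ m', m = d • m' := by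
  obtain ⟨t, ht, rfl⟩ := exists_eq_mk m
  obtain ⟨v, hv, rfl⟩ := h.exists_mem_I_eq_mul hd (hL.le ht)
  obtain ⟨y, hy, hdy⟩ := hL.exists_mul_eq d v hv ht
  exact ⟨mk I g hy, (mk_eq_mk ht (L.mul_mem_left d hy)).2
    ⟨0, zero_mem _, by rw [hdy, sub_self, zero_mul]⟩⟩

theorem exists_eq_smul_of_isExactPair (h : IsDubrovinPuninskiPair I K)
    (hL : IsPureEpiIdeal I K L g) {f e : S} (hf : f ∉ I) (he : e ∉ K) (hfe : IsExactPair f e)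
    {m : QuotMul I L g} (hm : e • m = 0) : ∃ m', m = f • m' := by
  obtain ⟨t, ht, rfl⟩ := exists_eq_mk m
  obtain ⟨z, hz, hez⟩ := (mk_eq_zero (L.mul_mem_left e ht)).1 hm
  obtain ⟨y, hy, rfl⟩ := h.exists_mem_I_eq_mul he hz
  obtain ⟨x, hx⟩ := hfe.exists_eq_mul_left (t - y * g)
    (by rw [mul_sub, hez, mul_assoc, sub_self])
  have hfx : f * x ∈ L := hx ▸ L.sub_mem ht (L.mul_mem_left _ hL.mem)
  obtain ⟨x', hx', hfx'⟩ := hL.exists_mul_eq f x (h.mem_I_of_mul_mem hf (hL.le hfx)) hfx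
  exact ⟨mk I g hx', (mk_eq_mk ht (L.mul_mem_left f hx')).2
    ⟨y, hy, by rw [hfx', ← hx, sub_sub_cancel]⟩⟩

theorem eq_zero_of_smul_eq_zero (h : IsDubrovinPuninskiPair I K) (hg : g ∉ K) {f : S}
    (hf : f ∉ I) {m : QuotMul I L g} (hm : f • m = 0) : m = 0 := by
  obtain ⟨t, ht, rfl⟩ := exists_eq_mk m
  obtain ⟨z, hz, hfz⟩ := (mk_eq_zero (L.mul_mem_left f ht)).1 hm
  obtain ⟨y, rfl⟩ : ∃ y, z = f * y := by
    by_cases hfK : f ∈ K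
    · obtain ⟨e, -, -, hfe⟩ := h.exists_isExactPair_right f hfK hf
      refine hfe.exists_eq_mul_left z (h.isRightRegular g hg ?_)
      change e * z * g = 0 * g
      rw [mul_assoc, ← hfz, ← mul_assoc, hfe.mul_eq_zero, zero_mul, zero_mul]
    · obtain ⟨f, rfl⟩ := h.isUnit f hf hfK
      exact ⟨↑f⁻¹ * z, (Units.mul_inv_cancel_left f z).symm⟩
  exact (mk_eq_zero ht).2
    ⟨y, h.mem_I_of_mul_mem hf hz, h.isLeftRegular f hf (hfz.trans (mul_assoc _ _ _))⟩

theorem exists_eq_smul_of_annihilator_le (h : IsDubrovinPuninskiPair I K)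
    (hL : IsPureEpiIdeal I K L g) (d : S) (m : QuotMul I L g)
    (hm : ∀ t, t * d = 0 → t • m = 0) : ∃ m', m = d • m' := by
  by_cases hd : d = 0
  · exact ⟨0, by rw [smul_zero, ← one_smul S m, hm 1 (by rw [hd, mul_zero])]⟩
  obtain ⟨f, k, hf, hk, rfl⟩ := h.exists_eq_mul d hd
  by_cases hfK : f ∈ K
  · obtain ⟨e, -, he, hfe⟩ := h.exists_isExactPair_right f hfK hf
    obtain ⟨m', rfl⟩ := exists_eq_smul_of_isExactPair h hL hf he hfe
      (hm e (by rw [← mul_assoc, hfe.mul_eq_zero, zero_mul]))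
    obtain ⟨m'', rfl⟩ := exists_eq_smul_of_notMem h hL hk m'
    exact ⟨m'', (mul_smul _ _ _).symm⟩
  · exact exists_eq_smul_of_notMem h hL (h.mul_notMem_K _ _ hfK hk) m

theorem liftsAnnihilators (h : IsDubrovinPuninskiPair I K) (hL : IsPureEpiIdeal I K L g) :
    LiftsAnnihilators S (QuotMul I L g) := by
  intro d m hm
  by_cases hd : d = 0
  · exact ⟨1, m, (one_smul S m).symm, by rw [hd, zero_mul]⟩
  obtain ⟨f, k, hf, hk, rfl⟩ := h.exists_eq_mul d hd
  have hkm : k • m = 0 := eq_zero_of_smul_eq_zero h hL.notMem hf (by rwa [smul_smul])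
  by_cases hkI : k ∈ I
  · obtain ⟨b, -, hb, hbk⟩ := h.exists_isExactPair_left k hkI hk
    obtain ⟨m', rfl⟩ := exists_eq_smul_of_isExactPair h hL hb hk hbk hkm
    exact ⟨b, m', rfl, by rw [mul_assoc, hbk.mul_eq_zero, mul_zero]⟩
  · exact ⟨0, 0, by rw [eq_zero_of_smul_eq_zero h hL.notMem hkI hkm, smul_zero], mul_zero _⟩

theorem comparable (h : IsDubrovinPuninskiPair I K) (hg : g ∉ K) (x y : QuotMul I L g) :
    (∃ a : S, x = a • y) ∨ ∃ a : S, y = a • x := by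
  obtain ⟨s, hs, rfl⟩ := exists_eq_mk x
  obtain ⟨t, ht, rfl⟩ := exists_eq_mk y
  exact (h.comparable_mod hg s t).imp
    (fun ⟨a, ha⟩ => ⟨a, (mk_eq_mk hs (L.mul_mem_left a ht)).2 ha⟩)
    fun ⟨a, ha⟩ => ⟨a, (mk_eq_mk ht (L.mul_mem_left a hs)).2 ha⟩

theorem isUniserial (h : IsDubrovinPuninskiPair I K) (hg : g ∉ K) :
    IsUniserial S (QuotMul I L g) :=
  isUniserial_of_comparable (comparable h hg)

theorem isFlat (h : IsDubrovinPuninskiPair I K) (hL : IsPureEpiIdeal I K L g) :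
    IsFlat S (QuotMul I L g) := by
  have hcyclic : IsLocallyCyclic S (QuotMul I L g) := fun x y => by
    rcases comparable h hL.notMem x y with ⟨a, ha⟩ | ⟨a, ha⟩
    · exact ⟨y, a, 1, ha, (one_smul S y).symm⟩
    · exact ⟨x, 1, a, (one_smul S x).symm, ha⟩
  exact hcyclic.isFlat (liftsAnnihilators h hL)

theorem isAbsolutelyPure (h : IsDubrovinPuninskiPair I K) (hL : IsPureEpiIdeal I K L g) :
    IsAbsolutelyPure S (QuotMul I L g) :=
  have := h.isBezout
  isAbsolutelyPure_of_extendsTo <| ExtendsTo.pi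
    (isLeftCoherent_of_exists_annihilator h.exists_annihilator)
    (ExtendsTo.of_isBezout (exists_eq_smul_of_annihilator_le h hL))

theorem pushoutMap_injective (h : IsDubrovinPuninskiPair I K) (hL : IsPureEpiIdeal I K L g) :
    Function.Injective (pushoutMap I L g hL.mem) := by
  refine (injective_iff_map_eq_zero _).2 fun x hx => ?_
  obtain ⟨x, rfl⟩ := Submodule.mkQ_surjective _ x
  obtain ⟨z, hz, hxz⟩ := (mk_eq_zero (L.mul_mem_left x hL.mem)).1 hx
  exact (Submodule.Quotient.mk_eq_zero _).2 (h.isRightRegular g hL.notMem hxz ▸ hz)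

end QuotMul

end PureIdeal

section Chains

variable {S : Type u} [Ring S] {M : Type v} [AddCommGroup M] [Module S M]
  {N : Type w} [AddCommGroup N] [Module S N] {x : ℕ → S} {m : ℕ → M} {n : ℕ → N}

theorem monotone_span_singleton_of_chain (hm : ∀ k, m k = x k • m (k + 1)) :
    Monotone fun k => Submodule.span S {m k} :=
  monotone_nat_of_le_succ fun k => (Submodule.span_singleton_le_iff_mem _ _).2 <|
    Submodule.mem_span_singleton.2 ⟨x k, (hm k).symm⟩

theorem mem_span_range_of_chain (hm : ∀ k, m k = x k • m (k + 1)) {y : M} :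
    y ∈ Submodule.span S (Set.range m) ↔ ∃ k, ∃ s : S, y = s • m k := by
  rw [Submodule.span_range_eq_iSup, Submodule.mem_iSup_of_directed _
    (monotone_span_singleton_of_chain hm).directed_le]
  simp only [Submodule.mem_span_singleton, eq_comm]

/-- The pairs `(m k, n k)` generate the graph of the morphism. -/
theorem exists_linearMap_of_chain (hm : ∀ k, m k = x k • m (k + 1))
    (hn : ∀ k, n k = x k • n (k + 1)) (hmn : ∀ k (s : S), s • m k = 0 → s • n k = 0) :
    ∃ φ : Submodule.span S (Set.range m) →ₗ[S] N,
      ∀ k, φ ⟨m k, Submodule.subset_span ⟨k, rfl⟩⟩ = n k := by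
  let Γ : Submodule S (M × N) := Submodule.span S (Set.range fun k => (m k, n k))
  have hΓ {z : M × N} : z ∈ Γ ↔ ∃ k, ∃ s : S, z = s • (m k, n k) :=
    mem_span_range_of_chain fun k => Prod.ext (hm k) (hn k)
  have hfst (z : Γ) : z.1.1 ∈ Submodule.span S (Set.range m) := by
    obtain ⟨k, s, hz⟩ := hΓ.1 z.2
    exact (mem_span_range_of_chain hm).2 ⟨k, s, congrArg Prod.fst hz⟩
  let π : Γ →ₗ[S] Submodule.span S (Set.range m) :=
    (LinearMap.fst S M N ∘ₗ Γ.subtype).codRestrict _ hfst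
  have hπ : Function.Surjective π := by
    rintro ⟨y, hy⟩
    obtain ⟨k, s, rfl⟩ := (mem_span_range_of_chain hm).1 hy
    exact ⟨⟨s • (m k, n k), hΓ.2 ⟨k, s, rfl⟩⟩, rfl⟩
  have hker : LinearMap.ker π ≤ LinearMap.ker (LinearMap.snd S M N ∘ₗ Γ.subtype) := by
    rintro ⟨z, hz⟩ hπz
    obtain ⟨k, s, rfl⟩ := hΓ.1 hz
    exact hmn k s (congrArg Subtype.val hπz)
  obtain ⟨φ, hφ⟩ := exists_comp_eq_of_ker_le hπ hker
  exact ⟨φ, fun k => LinearMap.congr_fun hφ ⟨(m k, n k), Submodule.subset_span ⟨k, rfl⟩⟩⟩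

end Chains

section Factoring

variable {S : Type u} [Ring S] {I K L : Ideal S} {g : S} {N : Type v} [AddCommGroup N] [Module S N]

theorem IsDubrovinPuninskiPair.isSemisimpleModule (h : IsDubrovinPuninskiPair I K)
    (hN : ∀ i ∈ I, ∀ x : N, i • x = 0) : IsSemisimpleModule S N := by
  have := h.isSimpleModule_quotient
  refine IsSemisimpleModule.of_sSup_simples_eq_top (eq_top_iff.2 fun x _ => ?_)
  let φ : (S ⧸ I) →ₗ[S] N := I.liftQ (LinearMap.toSpanSingleton S N x) fun i hi => hN i hi x
  have hx : φ (I.mkQ 1) = x := one_smul S x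
  rcases φ.injective_or_eq_zero with hφ | hφ
  · have : IsSimpleModule S (LinearMap.range φ) :=
      IsSimpleModule.congr (LinearEquiv.ofInjective φ hφ).symm
    exact le_sSup (a := LinearMap.range φ) this ⟨_, hx⟩
  · rw [← hx, hφ]
    exact zero_mem _

theorem IsDubrovinPuninskiPair.mem_smul_top_iff (h : IsDubrovinPuninskiPair I K) (hg : g ∈ I)
    (hgK : g ∉ K) {n : N} : n ∈ I • (⊤ : Submodule S N) ↔ ∃ n', n = g • n' := by
  refine ⟨fun hn => ?_, fun ⟨n', hn⟩ => hn ▸ Submodule.smul_mem_smul hg Submodule.mem_top⟩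
  refine Submodule.smul_induction_on hn (fun i hi n _ => ?_) ?_
  · obtain ⟨v, rfl⟩ := h.exists_eq_mul_left g hgK i hi
    exact ⟨v • n, mul_smul _ _ _⟩
  · rintro _ _ ⟨x, rfl⟩ ⟨y, rfl⟩
    exact ⟨x + y, (smul_add _ _ _).symm⟩

theorem IsDubrovinPuninskiPair.exists_mem_smul_top_eq_smul (h : IsDubrovinPuninskiPair I K) {x : S}
    (hx : x ∉ K) {n : N} (hn : n ∈ I • (⊤ : Submodule S N)) :
    ∃ n' ∈ I • (⊤ : Submodule S N), n = x • n' := by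
  obtain ⟨g, hg, hgK⟩ := h.exists_mem_I_notMem_K
  obtain ⟨n, rfl⟩ := (h.mem_smul_top_iff hg hgK).1 hn
  obtain ⟨v, hv, rfl⟩ := h.exists_mem_I_eq_mul hx hg
  exact ⟨v • n, Submodule.smul_mem_smul hv Submodule.mem_top, mul_smul _ _ _⟩

/-- Otherwise the simple module `S / I` embeds, and hence splits, in the semisimple `N / I N`. -/
theorem IsDubrovinPuninskiPair.mem_smul_top_of_not_isSplitMono (h : IsDubrovinPuninskiPair I K)
    {N : Type u} [AddCommGroup N] [Module S N] {q : (S ⧸ I) →ₗ[S] N} (hq : ¬ IsSplitMono q) :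
    q (I.mkQ 1) ∈ I • (⊤ : Submodule S N) := by
  let IN : Submodule S N := I • ⊤
  have := h.isSimpleModule_quotient
  have : IsSemisimpleModule S (N ⧸ IN) := h.isSemisimpleModule fun i hi x => by
    obtain ⟨x, rfl⟩ := IN.mkQ_surjective x
    exact (Submodule.Quotient.mk_eq_zero IN).2 (Submodule.smul_mem_smul hi Submodule.mem_top)
  rcases (IN.mkQ ∘ₗ q).injective_or_eq_zero with hinj | hzero
  · obtain ⟨r, hr⟩ := IsSemisimpleModule.extension_property _ hinj LinearMap.id
    exact absurd ⟨r ∘ₗ IN.mkQ, hr⟩ hq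
  · exact (Submodule.Quotient.mk_eq_zero IN).1 (LinearMap.congr_fun hzero _)

namespace IsPureEpiIdeal

theorem exists_notMem_eq_mul (h : IsDubrovinPuninskiPair I K) (hL : IsPureEpiIdeal I K L g) {s : S}
    (hs : s ∈ L) : ∃ t ∈ L, t ∉ K ∧ ∃ y, s = y * t := by
  by_cases hs0 : s = 0
  · exact ⟨g, hL.mem, hL.notMem, 0, by rw [hs0, zero_mul]⟩
  obtain ⟨f, k, hf, hk, rfl⟩ := h.exists_eq_mul s hs0
  obtain ⟨y, hy, hfy⟩ := hL.exists_mul_eq f k (h.mem_I_of_mul_mem hf (hL.le hs)) hs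
  exact ⟨k, h.isLeftRegular f hf hfy ▸ hy, hk, f, rfl⟩

theorem exists_common_notMem_eq_mul (h : IsDubrovinPuninskiPair I K) (hL : IsPureEpiIdeal I K L g)
    {s t : S} (hs : s ∈ L) (ht : t ∈ L) :
    ∃ e ∈ L, e ∉ K ∧ (∃ y, s = y * e) ∧ ∃ y, t = y * e := by
  obtain ⟨s', hs', hsK, y, rfl⟩ := hL.exists_notMem_eq_mul h hs
  obtain ⟨t', ht', htK, z, rfl⟩ := hL.exists_notMem_eq_mul h ht
  rcases h.comparable s' t' hsK htK with ⟨a, rfl⟩ | ⟨a, rfl⟩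
  · exact ⟨t', ht', htK, ⟨y * a, (mul_assoc _ _ _).symm⟩, z, rfl⟩
  · exact ⟨s', hs', hsK, ⟨y, rfl⟩, z * a, (mul_assoc _ _ _).symm⟩

theorem exists_chain (h : IsDubrovinPuninskiPair I K) (hL : IsPureEpiIdeal I K L g)
    (hc : ∃ s : Set S, s.Countable ∧ Ideal.span s = L) :
    ∃ t x : ℕ → S, t 0 = g ∧ (∀ k, t k ∉ K) ∧ (∀ k, t k = x k * t (k + 1)) ∧
      L = Ideal.span (Set.range t) := by
  obtain ⟨A, hA, rfl⟩ := hc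
  obtain ⟨σ, hσ⟩ := (hA.insert 0).exists_eq_range (Set.insert_nonempty _ _)
  have hσL (k) : σ k ∈ Ideal.span A :=
    Ideal.span_insert_zero (s := A) ▸ hσ ▸ Ideal.subset_span (Set.mem_range_self k)
  choose! next hnext hnextK hdiv hσdiv using fun k t (ht : t ∈ Ideal.span A) =>
    hL.exists_common_notMem_eq_mul h ht (hσL k)
  let t : ℕ → S := Nat.rec g next
  have ht (k) : t k ∈ Ideal.span A ∧ t k ∉ K :=
    k.rec ⟨hL.mem, hL.notMem⟩ fun k ih => ⟨hnext k _ ih.1, hnextK k _ ih.1⟩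
  choose x hx using fun k => hdiv k (t k) (ht k).1
  refine ⟨t, x, rfl, fun k => (ht k).2, hx, le_antisymm ?_ ?_⟩
  · rw [← Ideal.span_insert_zero, hσ, Ideal.span_le]
    rintro _ ⟨k, rfl⟩
    obtain ⟨y, hy⟩ := hσdiv k (t k) (ht k).1
    exact hy ▸ Ideal.mul_mem_left _ y (Ideal.subset_span ⟨k + 1, rfl⟩)
  · rw [Ideal.span_le]
    rintro _ ⟨k, rfl⟩
    exact (ht k).1

theorem exists_linearMap_eq (h : IsDubrovinPuninskiPair I K) (hL : IsPureEpiIdeal I K L g)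
    (hc : ∃ s : Set S, s.Countable ∧ Ideal.span s = L) {n : N}
    (hn : n ∈ I • (⊤ : Submodule S N)) : ∃ φ : L →ₗ[S] N, φ ⟨g, hL.mem⟩ = n := by
  obtain ⟨t, x, rfl, htK, hx, rfl⟩ := hL.exists_chain h hc
  have hxK (k) : x k ∉ K := fun hk => htK k (hx k ▸ h.mul_mem_K hk _)
  choose! next hnext hnext' using fun k (n : N) => h.exists_mem_smul_top_eq_smul (n := n) (hxK k)
  let ν : ℕ → N := Nat.rec n next
  have hν (k) : ν k ∈ I • (⊤ : Submodule S N) := k.rec hn fun k ih => hnext k _ ih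
  obtain ⟨φ, hφ⟩ := exists_linearMap_of_chain (n := ν) hx (fun k => hnext' k _ (hν k))
    fun k s hs => by
      rw [(h.isRightRegular _ (htK k)).mul_right_eq_zero_iff.1 hs, zero_smul]
  exact ⟨φ, hφ 0⟩

theorem exists_comp_pushoutMap_eq (h : IsDubrovinPuninskiPair I K) (hL : IsPureEpiIdeal I K L g)
    (hc : ∃ s : Set S, s.Countable ∧ Ideal.span s = L) {q : (S ⧸ I) →ₗ[S] N}
    (hq : q (I.mkQ 1) ∈ I • (⊤ : Submodule S N)) :
    ∃ k : QuotMul I L g →ₗ[S] N, k ∘ₗ pushoutMap I L g hL.mem = q := by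
  obtain ⟨φ, hφ⟩ := hL.exists_linearMap_eq h hc hq
  have hφz (z : S) : φ (z • ⟨g, hL.mem⟩) = q (I.mkQ z) := by
    rw [map_smul, hφ, ← map_smul, ← map_smul, smul_eq_mul, mul_one]
  refine ⟨Submodule.liftQ _ φ ?_, ?_⟩
  · rintro ⟨_, _⟩ ⟨z, hz, rfl⟩
    exact (hφz z).trans (by rw [Submodule.mkQ_apply, (Submodule.Quotient.mk_eq_zero _).2 hz,
      map_zero])
  · ext
    exact hφz 1

end IsPureEpiIdeal

end Factoring

section AlmostSplit

variable {S : Type u} [Ring S] {I K L : Ideal S} {g : S}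

theorem not_isSplitMono_pushoutMap (h : IsDubrovinPuninskiPair I K) (hL : IsPureEpiIdeal I K L g) :
    ¬ IsSplitMono (pushoutMap I L g hL.mem) := by
  rintro ⟨r, hr⟩
  obtain ⟨m, hm⟩ := QuotMul.exists_eq_smul_of_notMem h hL hL.notMem
    (pushoutMap I L g hL.mem (I.mkQ 1))
  obtain ⟨y, hy⟩ := I.mkQ_surjective (r m)
  have hgy : I.mkQ 1 = I.mkQ (g * y) := by
    rw [← smul_eq_mul, map_smul, hy, ← map_smul, ← hm]
    exact (LinearMap.congr_fun hr _).symm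
  have hmem : 1 - g * y ∈ I := (Submodule.Quotient.eq I).1 hgy
  exact h.ne_top_I <| (Ideal.eq_top_iff_one I).2 <|
    (I.sub_mem_iff_left (h.mul_mem_I (hL.le hL.mem) y)).1 hmem

theorem isLeftAlmostSplit_pushoutMap (h : IsDubrovinPuninskiPair I K)
    (hL : IsPureEpiIdeal I K L g) (hc : ∃ s : Set S, s.Countable ∧ Ideal.span s = L) :
    IsLeftAlmostSplit (pushoutMap I L g hL.mem) :=
  ⟨not_isSplitMono_pushoutMap h hL, fun _ _ _ _ hq =>
    hL.exists_comp_pushoutMap_eq h hc (h.mem_smul_top_of_not_isSplitMono hq)⟩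

theorem not_injective_quotient (h : IsDubrovinPuninskiPair I K) (hL : IsPureEpiIdeal I K L g) :
    ¬ Module.Injective S (S ⧸ I) := fun hinj => by
  obtain ⟨r, hr⟩ := hinj.out _ (QuotMul.pushoutMap_injective h hL) LinearMap.id
  exact not_isSplitMono_pushoutMap h hL ⟨r, LinearMap.ext hr⟩

/-- A generator would make `L` principal, generated by some `t ∉ K`; but `t = t * w` with `w ∈ L`
by purity, so that `t` would be invertible. -/
theorem QuotMul.span_singleton_ne_top (h : IsDubrovinPuninskiPair I K)
    (hL : IsPureEpiIdeal I K L g) (m : QuotMul I L g) : Submodule.span S {m} ≠ ⊤ := by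
  intro hm
  obtain ⟨s, hs, rfl⟩ := exists_eq_mk m
  obtain ⟨t, ht, htK, ⟨y, rfl⟩, y', hy'⟩ := hL.exists_common_notMem_eq_mul h hs hL.mem
  obtain ⟨v, hv, htv⟩ := h.exists_mem_I_eq_mul htK (hL.le ht)
  obtain ⟨w, hw, hwv⟩ := hL.exists_mul_eq t v hv (htv ▸ ht)
  obtain ⟨a, ha⟩ := Submodule.mem_span_singleton.1 (hm ▸ Submodule.mem_top (x := mk I g hw))
  obtain ⟨z, -, hz⟩ := (mk_eq_mk (L.mul_mem_left a hs) hw).1 ha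
  have hwt : w = (a * y - z * y') * t := by
    rw [sub_mul, mul_assoc, mul_assoc, ← hy', ← hz, sub_sub_cancel]
  have htt : 1 * t = t * (a * y - z * y') * t := by
    rw [one_mul, mul_assoc, ← hwt, hwv, ← htv]
  exact h.ne_top_I <| (Ideal.eq_top_iff_one I).2 <|
    h.isRightRegular t htK htt ▸ h.mul_mem_I (hL.le ht) _

/-- A left almost split morphism factors through a cyclic submodule of its codomain, which is
therefore everything if the morphism is minimal; `QuotMul` then would be cyclic, too. -/
theorem not_isMinimalLeftAlmostSplit (h : IsDubrovinPuninskiPair I K)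
    (hL : IsPureEpiIdeal I K L g) (hc : ∃ s : Set S, s.Countable ∧ Ideal.span s = L)
    {U : Type u} [AddCommGroup U] [Module S U] (q : (S ⧸ I) →ₗ[S] U) :
    ¬ IsMinimalLeftAlmostSplit q := by
  rintro ⟨hq, hmin⟩
  obtain ⟨k, hk⟩ := hq.2 _ _ (not_isSplitMono_pushoutMap h hL)
  obtain ⟨u, hu⟩ := (h.mem_smul_top_iff (hL.le hL.mem) hL.notMem).1
    (h.mem_smul_top_of_not_isSplitMono hq.1)
  let V : Submodule S U := Submodule.span S {u}
  have huV : u ∈ V := Submodule.mem_span_singleton_self u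
  have hqV (x) : q x ∈ V := by
    obtain ⟨x, rfl⟩ := I.mkQ_surjective x
    rw [← mul_one x, ← smul_eq_mul, map_smul, map_smul, hu]
    exact V.smul_mem _ (V.smul_mem _ huV)
  obtain ⟨l, hl⟩ := hL.exists_comp_pushoutMap_eq h hc (q := q.codRestrict V hqV) <|
    (h.mem_smul_top_iff (hL.le hL.mem) hL.notMem).2 ⟨⟨u, huV⟩, Subtype.ext hu⟩
  have hbij : Function.Bijective ((V.subtype ∘ₗ l) ∘ₗ k) := hmin _ <| by
    rw [LinearMap.comp_assoc, hk, LinearMap.comp_assoc, hl]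
    rfl
  have hU : Submodule.span S {u} = ⊤ := eq_top_iff.2 fun x _ => by
    obtain ⟨y, rfl⟩ := hbij.2 x
    exact (l (k y)).2
  have : Nontrivial U := by
    have hinj : Function.Injective (k ∘ₗ q) := hk ▸ QuotMul.pushoutMap_injective h hL
    have := h.isSimpleModule_quotient
    have := IsSimpleModule.nontrivial S (S ⧸ I)
    exact (show Function.Injective q from .of_comp hinj).nontrivial
  have hsurj := (QuotMul.isUniserial h hL.notMem).surjective_of_bijective_comp hbij
  refine QuotMul.span_singleton_ne_top h hL (k u) ?_
  rw [← Set.image_singleton, ← Submodule.map_span, hU, Submodule.map_top,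
    LinearMap.range_eq_top.2 hsurj]

theorem range_pushoutMap (h : IsDubrovinPuninskiPair I K) (hL : IsPureEpiIdeal I K L g) :
    LinearMap.range (pushoutMap I L g hL.mem) = socle S (QuotMul I L g) := by
  have := h.isSimpleModule_quotient
  exact (socle_eq_of_isSimpleModule (QuotMul.isUniserial h hL.notMem) <| IsSimpleModule.congr
    (LinearEquiv.ofInjective _ (QuotMul.pushoutMap_injective h hL)).symm).symm

end AlmostSplit

section AlmostSplitSequence

variable {S : Type u} [Ring S] {A B C : Type v} [AddCommGroup A] [Module S A] [AddCommGroup B]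
  [Module S B] [AddCommGroup C] [Module S C] {i : A →ₗ[S] B} {p : B →ₗ[S] C}
  {t : B →ₗ[S] B} {t' : C →ₗ[S] C}

/-- If `t'` factored as `p ∘ₗ k`, then `t - k ∘ₗ p` would induce a retraction of `i`. -/
theorem IsAlmostSplitSequence.isSplitEpi_of_comp_eq (h : IsAlmostSplitSequence i p)
    (ht : t ∘ₗ i = i) (ht' : t' ∘ₗ p = p ∘ₗ t) : IsSplitEpi t' := by
  obtain ⟨hi, hip, -, hil, hpr⟩ := h
  by_contra hns
  obtain ⟨k, hk⟩ := hpr.2 _ t' hns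
  have hrange : LinearMap.range (t - k ∘ₗ p) ≤ LinearMap.range i := by
    rw [← hip.linearMap_ker_eq, LinearMap.range_le_ker_iff, LinearMap.comp_sub,
      ← LinearMap.comp_assoc, hk, ht', sub_self]
  obtain ⟨r, hr⟩ := exists_comp_eq_of_range_le hi hrange
  refine hil.1 ⟨r, LinearMap.ext fun x => hi ?_⟩
  have hx := LinearMap.congr_fun hr (i x)
  rw [LinearMap.sub_apply, LinearMap.comp_apply k, hip.apply_apply_eq_zero, map_zero,
    sub_zero] at hx
  exact hx.trans (LinearMap.congr_fun ht x)

theorem IsAlmostSplitSequence.bijective_of_comp_eq (h : IsAlmostSplitSequence i p)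
    (ht : t ∘ₗ i = i) (ht' : t' ∘ₗ p = p ∘ₗ t) : Function.Bijective t' := by
  obtain ⟨c, hc⟩ := h.isSplitEpi_of_comp_eq ht ht'
  have hsplit : IsSplitEpi c := by
    by_contra hns
    obtain ⟨k, hk⟩ := h.2.2.2.2.2 _ c hns
    exact h.2.2.2.2.1 ⟨t ∘ₗ k, by
      rw [← LinearMap.comp_assoc, ← ht', LinearMap.comp_assoc, hk, hc]⟩
  obtain ⟨d, hd⟩ := hsplit
  have htd : t' = d := by
    rw [← LinearMap.comp_id t', ← hd, ← LinearMap.comp_assoc, hc, LinearMap.id_comp]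
  exact Function.bijective_iff_has_inverse.2
    ⟨c, fun x => by rw [htd]; exact LinearMap.congr_fun hd x, LinearMap.congr_fun hc⟩

theorem IsAlmostSplitSequence.isMinimalLeftAlmostSplit (h : IsAlmostSplitSequence i p) :
    IsMinimalLeftAlmostSplit i := by
  refine ⟨h.2.2.2.1, fun t ht => ?_⟩
  obtain ⟨-, hip, hp, -⟩ := id h
  have hker : LinearMap.ker p ≤ LinearMap.ker (p ∘ₗ t) := by
    rw [hip.linearMap_ker_eq, LinearMap.range_le_ker_iff, LinearMap.comp_assoc, ht,
      hip.linearMap_comp_eq_zero]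
  obtain ⟨t', ht'⟩ := exists_comp_eq_of_ker_le hp hker
  have ht'p (x) : t' (p x) = p (t x) := LinearMap.congr_fun ht' x
  have hti (y) : t (i y) = i y := LinearMap.congr_fun ht y
  have hbij := h.bijective_of_comp_eq ht ht'
  refine ⟨(injective_iff_map_eq_zero t).2 fun x hx => ?_, fun y => ?_⟩
  · have hpx : p x = 0 := (map_eq_zero_iff t' hbij.1).1 (by rw [ht'p, hx, map_zero])
    obtain ⟨y, rfl⟩ := (hip x).1 hpx
    rw [← hti, hx]
  · obtain ⟨c, hc⟩ := hbij.2 (p y)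
    obtain ⟨x, rfl⟩ := hp c
    obtain ⟨z, hz⟩ := (hip (y - t x)).1 (by rw [map_sub, ← ht'p, hc, sub_self])
    exact ⟨x + i z, by rw [map_add, hti, hz, add_sub_cancel]⟩

end AlmostSplitSequence

section Purity

variable {S : Type u} [Ring S]

theorem exists_comp_eq_of_projective {P A B : Type*} [AddCommGroup P] [Module S P]
    [Module.Projective S P] [AddCommGroup A] [Module S A] [AddCommGroup B] [Module S B]
    {f : A →ₗ[S] B} {t : P →ₗ[S] B} (h : LinearMap.range t ≤ LinearMap.range f) :
    ∃ y : P →ₗ[S] A, f ∘ₗ y = t := by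
  obtain ⟨y, hy⟩ := Module.projective_lifting_property f.rangeRestrict
    (t.codRestrict (LinearMap.range f) fun p => h ⟨p, rfl⟩) f.surjective_rangeRestrict
  exact ⟨y, LinearMap.ext fun p => congrArg Subtype.val (LinearMap.congr_fun hy p)⟩

theorem isPure_of_exists_eqOn {M : Type u} [AddCommGroup M] [Module S M] {N : Submodule S M}
    (h : ∀ (n : ℕ) (A : Submodule S (Fin n → S)) (Z : (Fin n → S) →ₗ[S] M), A.FG → A.map Z ≤ N →
      ∃ Y : (Fin n → S) →ₗ[S] M, LinearMap.range Y ≤ N ∧ Set.EqOn Y Z A) : IsPure N := by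
  intro G _ _ hG φ
  obtain ⟨n, A, e, hA⟩ := Module.FinitePresentation.exists_fin S G
  obtain ⟨Z, hZ⟩ := Module.projective_lifting_property N.mkQ (φ ∘ₗ e.symm.toLinearMap ∘ₗ A.mkQ)
    N.mkQ_surjective
  have hZA : A.map Z ≤ N := by
    rintro _ ⟨a, ha, rfl⟩
    rw [← Submodule.Quotient.mk_eq_zero N]
    refine (LinearMap.congr_fun hZ a).trans ?_
    change φ (e.symm (A.mkQ a)) = 0
    rw [Submodule.mkQ_apply, (Submodule.Quotient.mk_eq_zero A).2 ha, map_zero, map_zero]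
  obtain ⟨Y, hYN, hYZ⟩ := h n A Z hA hZA
  have hA : A ≤ LinearMap.ker (Z - Y) := fun a ha => by
    rw [LinearMap.mem_ker, LinearMap.sub_apply, hYZ ha, sub_self]
  refine ⟨A.liftQ (Z - Y) hA ∘ₗ e.toLinearMap, ?_⟩
  have hNY : N.mkQ ∘ₗ Y = 0 := LinearMap.range_le_ker_iff.1 (by rwa [N.ker_mkQ])
  have hlift : N.mkQ ∘ₗ A.liftQ (Z - Y) hA = φ ∘ₗ e.symm.toLinearMap := by
    ext1
    rw [LinearMap.comp_assoc, A.liftQ_mkQ, LinearMap.comp_sub, hZ, hNY, sub_zero]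
    rfl
  rw [← LinearMap.comp_assoc, hlift, LinearMap.comp_assoc, LinearEquiv.symm_comp,
    LinearMap.comp_id]

variable {I K L : Ideal S}

/-- If `t = p r` with `p ∈ I`, choose `m ∈ K \ I` with `x m = 0`: the unit `v = m + p` satisfies
`x p = x v`, so `r` can be traded for `v⁻¹ t`. -/
theorem exists_mul_eq_of_mem_span (h : IsDubrovinPuninskiPair I K) {x t d : S} (hx : x ∈ I)
    (hxK : x ∉ K) (ht : t ∉ K) (hd : d ∈ I) :
    ∃ c ∈ Ideal.span {t}, ∀ b, b * d ∈ Ideal.span {x * t} → b * c = b * d := by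
  by_cases hdt : d ∈ Ideal.span {t}
  · exact ⟨d, hdt, fun _ _ => rfl⟩
  obtain ⟨r, -, hrK, a, -, rfl⟩ := h.exists_notMem_K_mem_I_eq_mul hd
  have hrt : r ∉ Ideal.span {t} := fun hr => hdt (Ideal.mul_mem_left _ a hr)
  obtain ⟨y, rfl⟩ | ⟨p, rfl⟩ := h.comparable r t hrK ht
  · exact absurd (Ideal.mem_span_singleton'.2 ⟨y, rfl⟩) hrt
  have hpK : p ∉ K := h.notMem_of_mul_notMem_K ht
  have hpI : p ∈ I := by
    by_contra hpI
    obtain ⟨p, rfl⟩ := h.isUnit p hpI hpK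
    exact hrt (Ideal.mem_span_singleton'.2 ⟨↑p⁻¹, Units.inv_mul_cancel_left p r⟩)
  obtain ⟨m, hm, hmI, hmx⟩ := h.exists_isExactPair_left x hx hxK
  obtain ⟨v, hv⟩ := h.isUnit_add hm hmI hpI hpK
  have hxv : x * p * ↑v⁻¹ = x := by
    rw [Units.mul_inv_eq_iff_eq_mul, hv, mul_add, hmx.mul_eq_zero, zero_add]
  refine ⟨a * ↑v⁻¹ * (p * r), Ideal.mem_span_singleton'.2 ⟨_, rfl⟩, fun b hb => ?_⟩
  obtain ⟨b', hb'⟩ := Ideal.mem_span_singleton'.1 hb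
  have hba : b * a = b' * (x * p) := h.isRightRegular r hrK <| by
    simpa only [mul_assoc] using hb'.symm
  calc b * (a * ↑v⁻¹ * (p * r)) = b * a * ↑v⁻¹ * (p * r) := by simp only [mul_assoc]
    _ = b' * (x * p * ↑v⁻¹) * (p * r) := by rw [hba, mul_assoc b']
    _ = b * (a * r) := by rw [hxv, mul_assoc, hb']

theorem isPure_submoduleOf (h : IsDubrovinPuninskiPair I K) (hLI : L ≤ I)
    (hL : ∀ s ∈ L, ∃ x ∈ I, x ∉ K ∧ ∃ t ∈ L, t ∉ K ∧ s ∈ Ideal.span {x * t}) :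
    IsPure (L.submoduleOf I) := by
  have := h.isBezout
  refine isPure_of_exists_eqOn fun n A Z hA hZ => ?_
  let Z₀ : (Fin n → S) →ₗ[S] S := I.subtype ∘ₗ Z
  obtain ⟨d, hd⟩ := (IsBezout.isPrincipal_of_FG (LinearMap.range Z₀)
    (Submodule.fg_top _ |>.1 Module.Finite.fg_top)).principal
  obtain ⟨s, hs⟩ := (IsBezout.isPrincipal_of_FG (A.map Z₀) (hA.map Z₀)).principal
  have hdI : d ∈ I := by
    obtain ⟨y, hy⟩ : d ∈ LinearMap.range Z₀ := hd ▸ Submodule.mem_span_singleton_self d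
    exact hy ▸ (Z y).2
  have hsL : s ∈ L := by
    obtain ⟨a, ha, rfl⟩ : s ∈ A.map Z₀ := hs ▸ Submodule.mem_span_singleton_self s
    exact hZ ⟨a, ha, rfl⟩
  obtain ⟨x, hx, hxK, t, ht, htK, hst⟩ := hL s hsL
  obtain ⟨c, hc, hcd⟩ := exists_mul_eq_of_mem_span h hx hxK htK hdI
  have hcL : c ∈ L := (Ideal.span_singleton_le_iff_mem L).2 ht hc
  obtain ⟨Z', hZ'⟩ := exists_comp_eq_of_projective (f := rightMul d) (t := Z₀)
    (hd.trans (LinearMap.range_toSpanSingleton d).symm).le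
  have hZd (y) : Z' y * d = Z₀ y := LinearMap.congr_fun hZ' y
  refine ⟨LinearMap.toSpanSingleton S I ⟨c, hLI hcL⟩ ∘ₗ Z', ?_, fun a ha => Subtype.ext ?_⟩
  · rintro _ ⟨y, rfl⟩
    exact L.mul_mem_left (Z' y) hcL
  · refine (hcd (Z' a) ?_).trans (hZd a)
    have has : Z₀ a ∈ Ideal.span {s} := hs.le ⟨a, ha, rfl⟩
    exact hZd a ▸ (Ideal.span_singleton_le_iff_mem _).2 hst has

end Purity

section Existence

variable {S : Type u} [Ring S] {I K : Ideal S} {f g : S} {t : ℕ → S}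

/-- Sequences of epimorphisms in `I` whose left ideals `S t₀ ≤ S t₁ ≤ ⋯` have a pure union
`L ≤ I` with `L f = (L ∩ J) f = L ∩ J`. -/
structure IsOmegaChain (I K : Ideal S) (f : S) (t : ℕ → S) : Prop where
  mem k : t k ∈ I
  notMem k : t k ∉ K
  exists_eq_mul k : ∃ x ∈ I, t k = x * t (k + 1)
  mul_mem_span k : t k * f ∈ Ideal.span {t (k + 1)}
  exists_mul_eq_mul k : ∃ z ∈ I ⊓ K, z ∈ Ideal.span {t (k + 1)} ∧ f * t k = z * f

theorem IsDubrovinPuninskiPair.exists_omegaChain_succ (h : IsDubrovinPuninskiPair I K) (hfK : f ∈ K)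
    (hfI : f ∉ I) {t : S} (ht : t ∈ I) :
    ∃ t' ∈ I, t' ∉ K ∧ (∃ x ∈ I, t = x * t') ∧ t * f ∈ Ideal.span {t'} ∧
      ∃ z ∈ I ⊓ K, z ∈ Ideal.span {t'} ∧ f * t = z * f := by
  obtain ⟨z, hz, hzf⟩ := h.exists_mem_inf_eq_mul hfK hfI
    ⟨I.mul_mem_left f ht, h.mul_mem_K hfK t⟩
  obtain ⟨s, hs, -, ⟨x, hx, rfl⟩, y, -, hy⟩ :=
    h.exists_common_notMem_K_mem_I_eq_mul ht (h.mul_mem_I ht f)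
  obtain ⟨t', ht', htK', ⟨x', -, rfl⟩, w, -, hw⟩ := h.exists_common_notMem_K_mem_I_eq_mul hs hz.1
  exact ⟨t', ht', htK', ⟨x * x', h.mul_mem_I hx x', (mul_assoc _ _ _).symm⟩,
    Ideal.mem_span_singleton'.2 ⟨y * x', by rw [hy, mul_assoc]⟩,
    z, hz, Ideal.mem_span_singleton'.2 ⟨w, hw.symm⟩, hzf⟩

theorem IsDubrovinPuninskiPair.exists_isOmegaChain (h : IsDubrovinPuninskiPair I K) (hfK : f ∈ K)
    (hfI : f ∉ I) (hg : g ∈ I) (hgK : g ∉ K) : ∃ t, t 0 = g ∧ IsOmegaChain I K f t := by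
  choose! next hmem hnotMem hmul hspan hz using
    fun (t : S) (ht : t ∈ I) => h.exists_omegaChain_succ hfK hfI ht
  let t : ℕ → S := Nat.rec g fun _ => next
  have ht (k) : t k ∈ I ∧ t k ∉ K :=
    k.rec ⟨hg, hgK⟩ fun _ ih => ⟨hmem _ ih.1, hnotMem _ ih.1⟩
  exact ⟨t, rfl, fun k => (ht k).1, fun k => (ht k).2, fun k => hmul _ (ht k).1,
    fun k => hspan _ (ht k).1, fun k => hz _ (ht k).1⟩

namespace IsOmegaChain

theorem mem_span (t : ℕ → S) (k : ℕ) : t k ∈ Ideal.span (Set.range t) :=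
  Ideal.subset_span ⟨k, rfl⟩

theorem span_singleton_le (t : ℕ → S) (k : ℕ) :
    Ideal.span {t k} ≤ Ideal.span (Set.range t) :=
  Ideal.span_mono (Set.singleton_subset_iff.2 ⟨k, rfl⟩)

theorem span_le (ht : IsOmegaChain I K f t) : Ideal.span (Set.range t) ≤ I :=
  Ideal.span_le.2 (Set.range_subset_iff.2 ht.mem)

theorem mem_span_iff (ht : IsOmegaChain I K f t) {s : S} :
    s ∈ Ideal.span (Set.range t) ↔ ∃ k y, s = y * t k := by
  choose x _ hx using ht.exists_eq_mul
  exact mem_span_range_of_chain hx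

theorem isPure (h : IsDubrovinPuninskiPair I K) (ht : IsOmegaChain I K f t) :
    IsPure ((Ideal.span (Set.range t)).submoduleOf I) := by
  refine isPure_submoduleOf h ht.span_le fun s hs => ?_
  obtain ⟨k, y, rfl⟩ := ht.mem_span_iff.1 hs
  obtain ⟨x, hx, hxt⟩ := ht.exists_eq_mul k
  exact ⟨x, hx, h.notMem_of_mul_notMem_K (hxt ▸ ht.notMem k), t (k + 1), mem_span t _,
    ht.notMem _, Ideal.mem_span_singleton'.2 ⟨y, by rw [hxt]⟩⟩

theorem map_rightMul_le (h : IsDubrovinPuninskiPair I K) (hfK : f ∈ K)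
    (ht : IsOmegaChain I K f t) :
    Submodule.map (rightMul f) (Ideal.span (Set.range t)) ≤
      Ideal.span (Set.range t) ⊓ (I ⊓ K) := by
  rintro _ ⟨s, hs, rfl⟩
  refine ⟨?_, h.mul_mem_I (ht.span_le hs) f, K.mul_mem_left s hfK⟩
  obtain ⟨k, y, rfl⟩ := ht.mem_span_iff.1 hs
  change y * t k * f ∈ Ideal.span (Set.range t)
  rw [mul_assoc]
  exact Ideal.mul_mem_left _ y (span_singleton_le t _ (ht.mul_mem_span k))

theorem le_map_rightMul (h : IsDubrovinPuninskiPair I K) (hfI : f ∉ I)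
    (ht : IsOmegaChain I K f t) :
    Ideal.span (Set.range t) ⊓ (I ⊓ K) ≤
      Submodule.map (rightMul f) (Ideal.span (Set.range t) ⊓ (I ⊓ K)) := by
  rintro s ⟨hs, -, hsK⟩
  obtain ⟨k, y, rfl⟩ := ht.mem_span_iff.1 hs
  have hyK : y ∈ K := by
    by_contra hyK
    exact h.mul_notMem_K _ _ hyK (ht.notMem k) hsK
  obtain ⟨y, rfl⟩ := h.exists_eq_mul_right f hfI y hyK
  obtain ⟨z, hz, hzt, hfz⟩ := ht.exists_mul_eq_mul k
  refine ⟨y * z, Ideal.mul_mem_left _ y ⟨span_singleton_le t _ hzt, hz⟩, ?_⟩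
  change y * z * f = y * f * t k
  rw [mul_assoc, mul_assoc, hfz]

end IsOmegaChain

end Existence

section Omega

variable {R : Type u} [Ring R] {X : Type v} [AddCommGroup X] [Module Rᵐᵒᵖ X]
  {f g : Module.End Rᵐᵒᵖ X}

theorem IsShortExact.exists_isOmega (hfg : IsShortExact f g)
    (hR : IsNearlySimpleUniserialDomain R) (hX : IsCyclicallyPresentedTorsion R X) :
    ∃ Iω : Ideal (Module.End Rᵐᵒᵖ X), IsOmega hR hX f g Iω := by
  have h := isDubrovinPuninskiPair hR hX
  have hfI := hfg.left_notMem_I hR hX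
  have hfK := hfg.left_mem_K hR hX
  obtain ⟨t, rfl, ht⟩ := h.exists_isOmegaChain hfK hfI (hfg.right_mem_I hR hX)
    (hfg.right_notMem_K hR hX)
  have hmap := ht.map_rightMul_le h hfK
  have hle := ht.le_map_rightMul h hfI
  have hmono := Submodule.map_mono (f := rightMul f)
    (inf_le_left : Ideal.span (Set.range t) ⊓ idealJ hR hX ≤ _)
  exact ⟨Ideal.span (Set.range t), ht.span_le, ⟨_, Set.countable_range t, rfl⟩, ht.isPure h,
    IsOmegaChain.span_singleton_le t 0, le_antisymm hmap (hle.trans hmono),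
    le_antisymm (hmono.trans hmap) hle⟩

theorem IsOmega.isPureEpiIdeal {hR : IsNearlySimpleUniserialDomain R}
    {hX : IsCyclicallyPresentedTorsion R X} {Iω : Ideal (Module.End Rᵐᵒᵖ X)}
    (hω : IsOmega hR hX f g Iω) (hfg : IsShortExact f g) :
    IsPureEpiIdeal (idealI hR hX) (idealK hR hX) Iω g where
  le := hω.le_I
  mem := hω.g_mem
  notMem := hfg.right_notMem_K hR hX
  exists_mul_eq b x hx hbx := by
    obtain ⟨y, hy, hby⟩ := hω.pure.exists_smul_eq (b := b) (x := ⟨x, hx⟩) hbx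
    exact ⟨y, hy, congrArg Subtype.val hby⟩

end Omega

end DubrovinPuninski

theorem propositionA17 {R : Type u} [Ring R]
    (hR : DubrovinPuninski.IsNearlySimpleUniserialDomain R)
    {X : Type v} [AddCommGroup X] [Module Rᵐᵒᵖ X]
    (hX : DubrovinPuninski.IsCyclicallyPresentedTorsion R X) :
    -- the data exist
    (∃ f g : Module.End Rᵐᵒᵖ X, DubrovinPuninski.IsShortExact f g) ∧
    (∀ f g : Module.End Rᵐᵒᵖ X, DubrovinPuninski.IsShortExact f g →
      ∃ Iω : Ideal (Module.End Rᵐᵒᵖ X), DubrovinPuninski.IsOmega hR hX f g Iω) ∧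
    -- properties of `Iω / I g` and of `sω`
    (∀ f g : Module.End Rᵐᵒᵖ X, DubrovinPuninski.IsShortExact f g →
      ∀ (Iω : Ideal (Module.End Rᵐᵒᵖ X)) (hω : DubrovinPuninski.IsOmega hR hX f g Iω),
        DubrovinPuninski.IsAbsolutelyPure (Module.End Rᵐᵒᵖ X)
          (DubrovinPuninski.IomegaModIg hR hX g Iω) ∧
        DubrovinPuninski.IsFlat (Module.End Rᵐᵒᵖ X)
          (DubrovinPuninski.IomegaModIg hR hX g Iω) ∧
        DubrovinPuninski.IsUniserial (Module.End Rᵐᵒᵖ X)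
          (DubrovinPuninski.IomegaModIg hR hX g Iω) ∧
        Function.Injective (DubrovinPuninski.sOmega hω) ∧
        LinearMap.range (DubrovinPuninski.sOmega hω) =
          DubrovinPuninski.socle (Module.End Rᵐᵒᵖ X)
            (DubrovinPuninski.IomegaModIg hR hX g Iω) ∧
        DubrovinPuninski.IsLeftAlmostSplit (DubrovinPuninski.sOmega hω)) ∧
    -- `S / I` is simple and not injective
    IsSimpleModule (Module.End Rᵐᵒᵖ X)
      (Module.End Rᵐᵒᵖ X ⧸ DubrovinPuninski.idealI hR hX) ∧
    ¬ Module.Injective (Module.End Rᵐᵒᵖ X)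
      (Module.End Rᵐᵒᵖ X ⧸ DubrovinPuninski.idealI hR hX) ∧
    -- no minimal left almost split morphism starts at `S / I`
    (∀ (U : Type v) [AddCommGroup U] [Module (Module.End Rᵐᵒᵖ X) U]
      (q : (Module.End Rᵐᵒᵖ X ⧸ DubrovinPuninski.idealI hR hX) →ₗ[Module.End Rᵐᵒᵖ X] U),
      ¬ DubrovinPuninski.IsMinimalLeftAlmostSplit q) ∧
    -- no almost split sequence starts at `S / I`
    (∀ (B C : Type v) [AddCommGroup B] [Module (Module.End Rᵐᵒᵖ X) B]
      [AddCommGroup C] [Module (Module.End Rᵐᵒᵖ X) C]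
      (i : (Module.End Rᵐᵒᵖ X ⧸ DubrovinPuninski.idealI hR hX) →ₗ[Module.End Rᵐᵒᵖ X] B)
      (p : B →ₗ[Module.End Rᵐᵒᵖ X] C),
      ¬ DubrovinPuninski.IsAlmostSplitSequence i p) := by
  have h := DubrovinPuninski.isDubrovinPuninskiPair hR hX
  obtain ⟨f, g, hfg⟩ := hX.exists_isShortExact hR
  obtain ⟨Iω, hω⟩ := hfg.exists_isOmega hR hX
  have hL := hω.isPureEpiIdeal hfg
  refine ⟨⟨f, g, hfg⟩, fun f g hfg => hfg.exists_isOmega hR hX, fun f g hfg Iω hω => ?_,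
    h.isSimpleModule_quotient, DubrovinPuninski.not_injective_quotient h hL,
    fun U _ _ q => DubrovinPuninski.not_isMinimalLeftAlmostSplit h hL hω.countablyGenerated q,
    fun B C _ _ _ _ i p hip => DubrovinPuninski.not_isMinimalLeftAlmostSplit h hL
      hω.countablyGenerated i hip.isMinimalLeftAlmostSplit⟩
  have hL := hω.isPureEpiIdeal hfg
  exact ⟨DubrovinPuninski.QuotMul.isAbsolutelyPure h hL, DubrovinPuninski.QuotMul.isFlat h hL,
    DubrovinPuninski.QuotMul.isUniserial h hL.notMem,
    DubrovinPuninski.QuotMul.pushoutMap_injective h hL, DubrovinPuninski.range_pushoutMap h hL,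
    DubrovinPuninski.isLeftAlmostSplit_pushoutMap h hL hω.countablyGenerated⟩
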